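/- Let $n\ge 0$, let $\mathbb N^n$ be the free commutative monoid on generators $a_1,\dots,a_n$, written multiplicatively and regarded as a category with one object. For a small category $\mathcal C$, let $\mathfrak F\mathcal C$ be its category of factorizations: its objects are the morphisms of $\mathcal C$, a morphism $\alpha\to\beta$ is a pair $(f,g)$ of morphisms of $\mathcal C$ with $g\circ\alpha\circ f=\beta$, and the composite of $(f_1,g_1):\alpha\to\beta$ and $(f_2,g_2):\beta\to\gamma$ is $(f_1\circ f_2,\,g_2\circ g_1)$. Let $F:(\mathfrak F\mathbb N^n)^{op}\to\mathrm{Ab}$ be a contravariant natural system of abelian groups on $\mathbb N^n$. The Leech homology $H_k(\mathbb N^n,F)=\varinjlim_k^{(\mathfrak F\mathbb N^n)^{op}}F$ is the $k$-th homology group of the chain complex with groups $C_m=\bigoplus_{c_0\to\cdots\to c_m}F(c_0)$, the sum over all chains of $m$ morphisms in $(\mathfrak F\mathbb N^n)^{op}$, and differential $\sum_{i=0}^m(-1)^id_i$, where $d_i$ omits $c_i$ from the chain, and $d_0$ in addition applies $F(c_0\to c_1)$ to the coefficient. Let $\Box_+$ be the category with objects $\mathbb I^m=\{0,1\}^m$,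 $m\ge 0$, whose morphisms are the composites of the maps $\delta_s^{m,\varepsilon}:\mathbb I^{m-1}\to\mathbb I^m$ that insert $\varepsilon\in\{0,1\}$ as the $s$-th coordinate. A precubical set is a functor $X:\Box_+^{op}\to\mathrm{Set}$, with $X_m=X(\mathbb I^m)$; the objects of $\Box_+/X$ are the pairs $(\mathbb I^m,\sigma)$ with $\sigma\in X_m$, and a morphism $(\mathbb I^l,\rho)\to(\mathbb I^m,\sigma)$ is a morphism $f:\mathbb I^l\to\mathbb I^m$ of $\Box_+$ with $X(f)(\sigma)=\rho$. For a functor $G:(\Box_+/X)^{op}\to\mathrm{Ab}$, $H_k(X,G)$ is the $k$-th homology group of the chain complex $C_m(X,G)=\bigoplus_{\sigma\in X_m}G(\sigma)$ with $d_m=\sum_{s=1}^m(-1)^s(d_s^{m,1}-d_s^{m,0})$, where $d_s^{m,\varepsilon}$ maps the summand of $\sigma$ to the summand of $\partial_s^{\varepsilon}\sigma=X(\delta_s^{m,\varepsilon})(\sigma)$ by $G(\delta_s^{m,\varepsilon}:\partial_s^{\varepsilon}\sigma\to\sigma)$. Let $T^n_*$ be the precubical set with $T^n_k=\{a_{i_1}a_{i_2}\cdots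 a_{i_k}:1\le i_1<\dots<i_k\le n\}$ and $\partial_s^0=\partial_s^1$ the map that omits the factor $a_{i_s}$. Let $\mathfrak FT^n\subset\mathfrak F\mathbb N^n$ be the full subcategory on the square-free monomials, and let $\mathfrak S:\Box_+/T^n_*\to\mathfrak FT^n$ be the functor that takes each monomial to itself, the morphism $a_{i_1}\cdots\widehat{a_{i_s}}\cdots a_{i_k}\to a_{i_1}\cdots a_{i_k}$ given by $\delta^{k,0}_s$ to $(a_{i_s},1)$, and the one given by $\delta^{k,1}_s$ to $(1,a_{i_s})$. Put $\overline F=F|_{(\mathfrak FT^n)^{op}}\circ\mathfrak S^{op}$. Then for all $k\ge 0$ there is an isomorphism $$H_k(\mathbb N^n,F)\cong H_k(T^n_*,\overline F).$$ Consequently, for all $k\ge 0$, $H_k(\mathbb N^n,F)$ is isomorphic to the $k$-th homology group of the chain complex $$0\leftarrow F(1)\xleftarrow{d_1}\bigoplus_{1\le i_1\le n}F(a_{i_1})\xleftarrow{d_2}\bigoplus_{1\le i_1<i_2\le n}F(a_{i_1}a_{i_2})\leftarrow\cdots\xleftarrow{d_n}F(a_1a_2\cdots a_n)\leftarrow 0,$$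 which is zero in all degrees $k>n$, and whose differential takes $\varphi\in F(a_{i_1}\cdots a_{i_k})$ to $$d_k\varphi=\sum_{s=1}^k(-1)^s\Bigl(F\bigl((1,a_{i_s})\bigr)\varphi-F\bigl((a_{i_s},1)\bigr)\varphi\Bigr),$$ the $s$-th term lying in the summand $F(a_{i_1}\cdots\widehat{a_{i_s}}\cdots a_{i_k})$, where $(1,a_{i_s})$ and $(a_{i_s},1)$ are the two morphisms $a_{i_1}\cdots\widehat{a_{i_s}}\cdots a_{i_k}\to a_{i_1}\cdots a_{i_k}$. -/

import Mathlib

open CategoryTheory CategoryTheory.Limits Opposite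

universe u

noncomputable section

namespace LeechCubical

/-! ## Homology of small categories with coefficients in a functor -/

/-- `Cₙ(C, F) = ⨁_{c₀ ⟶ ⋯ ⟶ cₙ} F(c₀)`, the sum over all chains of `n` morphisms of `C`. -/
def catChains {C : Type} [SmallCategory C] (F : C ⥤ AddCommGrpCat.{u}) (n : ℕ) :
    AddCommGrpCat.{u} :=
  ∐ fun s : ComposableArrows C n => F.obj (s.obj 0)

/-- The inclusion of the summand of a chain. -/
def catι {C : Type} [SmallCategory C] (F : C ⥤ AddCommGrpCat.{u}) {n : ℕ}
    (s : ComposableArrows C n) : F.obj (s.obj 0) ⟶ catChains F n :=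
  Sigma.ι (fun s : ComposableArrows C n => F.obj (s.obj 0)) s

lemma catChains_hom_ext {C : Type} [SmallCategory C] {F : C ⥤ AddCommGrpCat.{u}} {n : ℕ}
    {A : AddCommGrpCat.{u}} {p q : catChains F n ⟶ A}
    (h : ∀ s : ComposableArrows C n, catι F s ≫ p = catι F s ≫ q) : p = q :=
  Sigma.hom_ext _ _ h

/-- The homomorphism induced by a monotone map `[m] → [n]`: it takes the summand of a chain
`c₀ ⟶ ⋯ ⟶ cₙ` to the summand of the composite of the chain with the map, through the value of `F`
at the arrow from `c₀` to the first object of the new chain. -/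
def catOperator {C : Type} [SmallCategory C] (F : C ⥤ AddCommGrpCat.{u}) {m n : ℕ}
    (φ : Fin (m + 1) →o Fin (n + 1)) : catChains F n ⟶ catChains F m :=
  Sigma.desc fun s : ComposableArrows C n =>
    F.map (s.map (homOfLE (Fin.zero_le (φ 0)))) ≫ catι F (s.whiskerLeft φ.monotone.functor)

lemma catι_catOperator {C : Type} [SmallCategory C] (F : C ⥤ AddCommGrpCat.{u}) {m n : ℕ}
    (φ : Fin (m + 1) →o Fin (n + 1)) (s : ComposableArrows C n) :
    catι F s ≫ catOperator F φ =
      F.map (s.map (homOfLE (Fin.zero_le (φ 0)))) ≫ catι F (s.whiskerLeft φ.monotone.functor) :=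
  Sigma.ι_desc _ _

lemma catOperator_id {C : Type} [SmallCategory C] (F : C ⥤ AddCommGrpCat.{u}) (n : ℕ) :
    catOperator F (OrderHom.id : Fin (n + 1) →o Fin (n + 1)) = 𝟙 _ := by
  refine catChains_hom_ext fun s => ?_
  rw [catι_catOperator, Category.comp_id]
  have h : F.map (s.map (homOfLE (Fin.zero_le (0 : Fin (n + 1))))) = 𝟙 (F.obj (s.obj 0)) := by
    rw [← F.map_id, ← s.map_id]; rfl
  exact (congrArg (fun e => e ≫ catι F s) h).trans (Category.id_comp _)

lemma catOperator_comp {C : Type} [SmallCategory C] (F : C ⥤ AddCommGrpCat.{u}) {l m n : ℕ}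
    (ψ : Fin (l + 1) →o Fin (m + 1)) (φ : Fin (m + 1) →o Fin (n + 1)) :
    catOperator F (φ.comp ψ) = catOperator F φ ≫ catOperator F ψ := by
  refine catChains_hom_ext fun s => ?_
  rw [← Category.assoc, catι_catOperator, catι_catOperator]
  refine Eq.trans ?_ (Category.assoc _ _ _).symm
  have h₁ : F.map (s.map (homOfLE (Fin.zero_le ((φ.comp ψ) 0)))) =
      F.map (s.map (homOfLE (Fin.zero_le (φ 0)))) ≫
        F.map (s.map (homOfLE (φ.monotone (Fin.zero_le (ψ 0))))) := by
    rw [← F.map_comp, ← s.map_comp]; rfl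
  exact (congrArg (fun e => e ≫ catι F (s.whiskerLeft (φ.comp ψ).monotone.functor)) h₁).trans
    ((Category.assoc _ _ _).trans
      (congrArg (fun e => F.map (s.map (homOfLE (Fin.zero_le (φ 0)))) ≫ e)
        (catι_catOperator F ψ (s.whiskerLeft φ.monotone.functor)).symm))

/-- The simplicial abelian group `[n] ↦ Cₙ(C, F)`. -/
def simplicialReplacement {C : Type} [SmallCategory C] (F : C ⥤ AddCommGrpCat.{u}) :
    SimplicialObject AddCommGrpCat.{u} where
  obj Δ := catChains F Δ.unop.len
  map φ := catOperator F φ.unop.toOrderHom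
  map_id Δ := catOperator_id F Δ.unop.len
  map_comp φ ψ := catOperator_comp F ψ.unop.toOrderHom φ.unop.toOrderHom

/-- The chain complex `C_*(C, F)`, with `Cₙ(C, F) = ⨁_{c₀ ⟶ ⋯ ⟶ cₙ} F(c₀)` and
`dₙ = ∑ᵢ (-1)ⁱ dᵢ`, where `dᵢ` drops the object `cᵢ` (and `d₀` applies `F(c₀ ⟶ c₁)`). -/
def catComplex {C : Type} [SmallCategory C] (F : C ⥤ AddCommGrpCat.{u}) :
    ChainComplex AddCommGrpCat.{u} ℕ :=
  (AlgebraicTopology.alternatingFaceMapComplex AddCommGrpCat.{u}).obj (simplicialReplacement F)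

/-- `lim→ₖ^C F`, the `k`-th homology group of the small category `C` with coefficients in `F`. -/
def catHomology {C : Type} [SmallCategory C] (F : C ⥤ AddCommGrpCat.{u}) (k : ℕ) :
    AddCommGrpCat.{u} :=
  (catComplex F).homology k

/-! ## The category of factorizations and Leech homology -/

/-- Objects of the category of factorizations of `C`: the morphisms of `C`. -/
structure Factorizations (C : Type) [SmallCategory C] : Type where
  {dom : C}
  {cod : C}
  arrow : dom ⟶ cod

namespace Factorizations

/-- A morphism `α ⟶ β` in the category of factorizations is a pair `(f, g)` with
`g ∘ α ∘ f = β`. -/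
@[ext]
structure Hom {C : Type} [SmallCategory C] (α β : Factorizations C) : Type where
  f : β.dom ⟶ α.dom
  g : α.cod ⟶ β.cod
  w : f ≫ α.arrow ≫ g = β.arrow

/-- The composite of `(f₁, g₁)` and `(f₂, g₂)` is `(f₁ ∘ f₂, g₂ ∘ g₁)`. -/
instance (C : Type) [SmallCategory C] : SmallCategory (Factorizations C) where
  Hom := Hom
  id α := ⟨𝟙 _, 𝟙 _, by simp⟩
  comp p q := ⟨q.f ≫ p.f, p.g ≫ q.g, by
    rw [← q.w, ← p.w]; simp only [Category.assoc]⟩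
  id_comp p := Hom.ext (Category.comp_id _) (Category.id_comp _)
  comp_id p := Hom.ext (Category.id_comp _) (Category.comp_id _)
  assoc p q r := Hom.ext (Category.assoc _ _ _).symm (Category.assoc _ _ _)

@[ext]
lemma hom_ext {C : Type} [SmallCategory C] {α β : Factorizations C} {p q : α ⟶ β}
    (hf : p.f = q.f) (hg : p.g = q.g) : p = q :=
  Hom.ext hf hg

/-- An element of a monoid (a category with one object) as an object of the category of
factorizations. -/
def ofElement {M : Type} [Monoid M] (a : M) : Factorizations (SingleObj M) :=
  { dom := SingleObj.star M, cod := SingleObj.star M, arrow := (a : M) }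

/-- The morphism `(x, y) : a ⟶ b` of the category of factorizations of a monoid, for
`y * a * x = b`. -/
def homOfElements {M : Type} [Monoid M] {a b : M} (x y : M) (h : y * a * x = b) :
    ofElement a ⟶ ofElement b :=
  { f := (x : M), g := (y : M), w := h }

end Factorizations

/-- The category of factorizations of a monoid. -/
abbrev MonoidFactorizations (M : Type) [Monoid M] : Type := Factorizations (SingleObj M)

/-- Contravariant natural systems of abelian groups on a monoid. -/
abbrev NaturalSystem (M : Type) [Monoid M] := (MonoidFactorizations M)ᵒᵖ ⥤ AddCommGrpCat.{u}

/-- The `k`-th Leech homology group `H_k(M, F)`. -/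
def leechHomology (M : Type) [Monoid M] (F : NaturalSystem.{u} M) (k : ℕ) : AddCommGrpCat.{u} :=
  catHomology F k

/-! ## The category `□₊` and precubical sets -/

/-- The coface `δᵢ^ε : 𝕀^n → 𝕀^(n+1)`, `𝕀 = {0, 1}`, inserting `ε` at place `i`. -/
def coface {n : ℕ} (i : Fin (n + 1)) (ε : Fin 2) (x : Fin n → Fin 2) : Fin (n + 1) → Fin 2 :=
  i.insertNth (α := fun _ => Fin 2) ε x

/-- The maps `𝕀^m → 𝕀^n` that are composites of cofaces (including the identities). -/
inductive IsFace : {m n : ℕ} → ((Fin m → Fin 2) → (Fin n → Fin 2)) → Prop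
  | id (n : ℕ) : IsFace (fun x : Fin n → Fin 2 => x)
  | coface_comp {m n : ℕ} {f : (Fin m → Fin 2) → (Fin n → Fin 2)} (i : Fin (n + 1)) (ε : Fin 2)
      (hf : IsFace f) : IsFace (fun x => coface i ε (f x))

lemma IsFace.comp {l m n : ℕ} {g : (Fin l → Fin 2) → (Fin m → Fin 2)}
    {f : (Fin m → Fin 2) → (Fin n → Fin 2)} (hg : IsFace g) (hf : IsFace f) :
    IsFace (fun x => f (g x)) := by
  induction hf with
  | id => exact hg
  | coface_comp i ε hf ih => exact IsFace.coface_comp i ε ih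

/-- Objects of `□₊`: the object with `dim = n` is `𝕀^n`. -/
structure BoxPlus : Type where
  dim : ℕ

namespace BoxPlus

@[ext]
structure Hom (m n : BoxPlus) : Type where
  toFun : (Fin m.dim → Fin 2) → (Fin n.dim → Fin 2)
  isFace : IsFace toFun

instance : SmallCategory BoxPlus where
  Hom := Hom
  id n := ⟨fun x => x, IsFace.id _⟩
  comp g f := ⟨fun x => f.toFun (g.toFun x), g.isFace.comp f.isFace⟩

@[ext]
lemma hom_ext {m n : BoxPlus} {f g : m ⟶ n} (h : f.toFun = g.toFun) : f = g := Hom.ext h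

/-- The morphism `δᵢ^ε : 𝕀^n → 𝕀^(n+1)` of `□₊`. -/
def δ {n : ℕ} (i : Fin (n + 1)) (ε : Fin 2) : (⟨n⟩ : BoxPlus) ⟶ ⟨n + 1⟩ :=
  ⟨coface i ε, IsFace.coface_comp i ε (IsFace.id n)⟩

lemma δ_comp_δ {n : ℕ} (i j : Fin (n + 1)) (h : i ≤ j) (α β : Fin 2) :
    δ i α ≫ δ j.succ β = δ j β ≫ δ i.castSucc α := by
  apply hom_ext
  funext x
  change coface j.succ β (coface i α x) = coface i.castSucc α (coface j β x)
  rw [coface, Fin.insertNth_eq_iff]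
  constructor
  · have h₁ : j.succ = i.castSucc.succAbove j := (Fin.succAbove_castSucc_of_le i j h).symm
    rw [h₁, coface, Fin.insertNth_apply_succAbove, coface, Fin.insertNth_apply_same]
  · rw [coface, Fin.insertNth_eq_iff]
    constructor
    · have h₁ : j.succ.succAbove i = i.castSucc := Fin.succAbove_succ_of_le j i h
      simp only [Fin.removeNth, h₁]
      exact (Fin.insertNth_apply_same (α := fun _ => Fin 2) _ _ _).symm
    · funext k
      have h₂ : j.succ.succAbove (i.succAbove k) = i.castSucc.succAbove (j.succAbove k) := by
        simp only [Fin.succAbove, Fin.lt_def, Fin.le_def] at h ⊢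
        split_ifs <;> simp_all [Fin.ext_iff] <;> omega
      simp only [Fin.removeNth, h₂]
      rw [coface, Fin.insertNth_apply_succAbove, coface, Fin.insertNth_apply_succAbove]

end BoxPlus

/-- Precubical sets as functors `□₊ᵒᵖ ⥤ Set`. -/
abbrev PrecubicalSet : Type 1 := BoxPlusᵒᵖ ⥤ Type

/-- Objects of the category `□₊/X` of cubes of a precubical set. -/
structure Cubes (X : PrecubicalSet) : Type where
  box : BoxPlus
  cell : X.obj (op box)

namespace Cubes

/-- A morphism `σ ⟶ τ` in `□₊/X` is a morphism `f` of `□₊` with `X(f)(τ) = σ`. -/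
@[ext]
structure Hom {X : PrecubicalSet} (σ τ : Cubes X) : Type where
  f : σ.box ⟶ τ.box
  w : X.map f.op τ.cell = σ.cell

instance (X : PrecubicalSet) : SmallCategory (Cubes X) where
  Hom := Hom
  id σ := ⟨𝟙 _, by simp⟩
  comp p q := ⟨p.f ≫ q.f, by
    rw [op_comp, Functor.map_comp]
    exact (congrArg (X.map p.f.op) q.w).trans p.w⟩
  id_comp p := Hom.ext (Category.id_comp _)
  comp_id p := Hom.ext (Category.comp_id _)
  assoc p q r := Hom.ext (Category.assoc _ _ _)

@[ext]
lemma hom_ext {X : PrecubicalSet} {σ τ : Cubes X} {p q : σ ⟶ τ} (h : p.f = q.f) : p = q :=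
  Hom.ext h

/-- The morphism `f : X(f)(σ) ⟶ σ` of `□₊/X` determined by a cube `σ` and a morphism `f`
of `□₊`. -/
def restrict {X : PrecubicalSet} {m n : BoxPlus} (f : m ⟶ n) (σ : X.obj (op n)) :
    (⟨m, X.map f.op σ⟩ : Cubes X) ⟶ ⟨n, σ⟩ :=
  ⟨f, rfl⟩

end Cubes

/-- Homological systems of abelian groups on a precubical set. -/
abbrev HomologicalSystem (X : PrecubicalSet) := (Cubes X)ᵒᵖ ⥤ AddCommGrpCat.{u}

/-! ## Homology of a precubical set with coefficients in a homological system -/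

/-- `Cₙ(X, F) = ⨁_{σ ∈ Xₙ} F(σ)`. -/
def cubicalChains {X : PrecubicalSet} (F : HomologicalSystem.{u} X) (n : ℕ) :
    AddCommGrpCat.{u} :=
  ∐ fun σ : X.obj (op ⟨n⟩) => F.obj (op ⟨⟨n⟩, σ⟩)

/-- The inclusion of the summand of a cube. -/
def cubicalι {X : PrecubicalSet} (F : HomologicalSystem.{u} X) {n : ℕ} (σ : X.obj (op ⟨n⟩)) :
    F.obj (op ⟨⟨n⟩, σ⟩) ⟶ cubicalChains F n :=
  Sigma.ι (fun σ : X.obj (op ⟨n⟩) => F.obj (op ⟨⟨n⟩, σ⟩)) σ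

lemma cubicalChains_hom_ext {X : PrecubicalSet} {F : HomologicalSystem.{u} X} {n : ℕ}
    {A : AddCommGrpCat.{u}} {p q : cubicalChains F n ⟶ A}
    (h : ∀ σ : X.obj (op ⟨n⟩), cubicalι F σ ≫ p = cubicalι F σ ≫ q) : p = q :=
  Sigma.hom_ext _ _ h

/-- The homomorphism `Cₙ(X, F) ⟶ Cₘ(X, F)` induced by a morphism `f : 𝕀^m → 𝕀^n`: it takes the
summand of `σ` to the summand of `X(f)(σ)` through `F(f : X(f)(σ) ⟶ σ)`. -/
def cubicalFace {X : PrecubicalSet} (F : HomologicalSystem.{u} X) {m n : ℕ}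
    (f : (⟨m⟩ : BoxPlus) ⟶ ⟨n⟩) : cubicalChains F n ⟶ cubicalChains F m :=
  Sigma.desc fun σ : X.obj (op ⟨n⟩) =>
    F.map (Cubes.restrict f σ).op ≫ cubicalι F (X.map f.op σ)

lemma cubicalι_face {X : PrecubicalSet} (F : HomologicalSystem.{u} X) {m n : ℕ}
    (f : (⟨m⟩ : BoxPlus) ⟶ ⟨n⟩) (σ : X.obj (op ⟨n⟩)) :
    cubicalι F σ ≫ cubicalFace F f =
      F.map (Cubes.restrict f σ).op ≫ cubicalι F (X.map f.op σ) :=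
  Sigma.ι_desc _ _

lemma map_cubicalι_congr {X : PrecubicalSet} (F : HomologicalSystem.{u} X) {m : ℕ} {σ : Cubes X}
    {τ τ' : X.obj (op ⟨m⟩)} (p : (⟨⟨m⟩, τ⟩ : Cubes X) ⟶ σ) (p' : (⟨⟨m⟩, τ'⟩ : Cubes X) ⟶ σ)
    (h : p.f = p'.f) :
    F.map p.op ≫ cubicalι F τ = F.map p'.op ≫ cubicalι F τ' := by
  obtain rfl : τ = τ' := by
    have h₁ : X.map p.f.op σ.cell = τ := p.w
    have h₂ : X.map p'.f.op σ.cell = τ' := p'.w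
    rw [← h₁, ← h₂, h]
  obtain rfl : p = p' := Cubes.hom_ext h
  rfl

lemma cubicalFace_comp {X : PrecubicalSet} (F : HomologicalSystem.{u} X) {l m n : ℕ}
    (g : (⟨l⟩ : BoxPlus) ⟶ ⟨m⟩) (f : (⟨m⟩ : BoxPlus) ⟶ ⟨n⟩) :
    cubicalFace F f ≫ cubicalFace F g = cubicalFace F (g ≫ f) := by
  refine cubicalChains_hom_ext fun σ => ?_
  rw [cubicalι_face, ← Category.assoc, cubicalι_face, Category.assoc, cubicalι_face,
    ← Category.assoc, ← F.map_comp, ← op_comp]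
  exact map_cubicalι_congr F (Cubes.restrict g _ ≫ Cubes.restrict f σ) _ rfl

/-- `d_{n+1} = ∑ᵢ (-1)^i (dᵢ^1 - dᵢ^0)`, the sum over `1 ≤ i ≤ n + 1`; here the place `i` is
counted from `0`. -/
def cubicalD {X : PrecubicalSet} (F : HomologicalSystem.{u} X) (n : ℕ) :
    cubicalChains F (n + 1) ⟶ cubicalChains F n :=
  ∑ i : Fin (n + 1), (-1 : ℤ) ^ ((i : ℕ) + 1) •
    (cubicalFace F (BoxPlus.δ i 1) - cubicalFace F (BoxPlus.δ i 0))

lemma cubicalι_D {X : PrecubicalSet} (F : HomologicalSystem.{u} X) {n : ℕ}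
    (σ : X.obj (op ⟨n + 1⟩)) :
    cubicalι F σ ≫ cubicalD F n = ∑ i : Fin (n + 1), (-1 : ℤ) ^ ((i : ℕ) + 1) •
      (F.map (Cubes.restrict (BoxPlus.δ i 1) σ).op ≫ cubicalι F (X.map (BoxPlus.δ i 1).op σ) -
        F.map (Cubes.restrict (BoxPlus.δ i 0) σ).op ≫
          cubicalι F (X.map (BoxPlus.δ i 0).op σ)) := by
  simp only [cubicalD, Preadditive.comp_sum, Preadditive.comp_zsmul, Preadditive.comp_sub,
    cubicalι_face]

lemma cubicalD_comp {X : PrecubicalSet} (F : HomologicalSystem.{u} X) (n : ℕ) :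
    cubicalD F (n + 1) ≫ cubicalD F n = 0 := by
  simp only [cubicalD, Preadditive.comp_sum, Preadditive.sum_comp, ← Finset.sum_product']
  let P := Fin (n + 1) × Fin (n + 2)
  let S : Finset P := Finset.univ.filter fun ij => (ij.2 : ℕ) ≤ (ij.1 : ℕ)
  rw [Finset.univ_product_univ, ← Finset.sum_add_sum_compl S, ← eq_neg_iff_add_eq_zero,
    ← Finset.sum_neg_distrib]
  let φ : ∀ ij : P, ij ∈ S → P := fun ij hij =>
    (Fin.castLT ij.2 (lt_of_le_of_lt (Finset.mem_filter.mp hij).right (Fin.is_lt ij.1)), ij.1.succ)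
  apply Finset.sum_bij φ
  · intro ij hij
    simp_rw [S, φ, Finset.compl_filter, Finset.mem_filter_univ, Fin.val_succ,
      Fin.val_castLT] at hij ⊢
    lia
  · rintro ⟨i, j⟩ hij ⟨i', j'⟩ hij' h
    rw [Prod.mk_inj]
    exact ⟨by simpa [φ] using! congr_arg Prod.snd h,
      by simpa [φ, Fin.castSucc_castLT] using! congr_arg Fin.castSucc (congr_arg Prod.fst h)⟩
  · rintro ⟨i', j'⟩ hij'
    simp_rw [S, Finset.compl_filter, Finset.mem_filter_univ, not_le] at hij'
    refine ⟨(j'.pred <| ?_, Fin.castSucc i'), ?_, ?_⟩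
    · rintro rfl
      simp only [Fin.val_zero, not_lt_zero] at hij'
    · simpa [S] using! Nat.le_sub_one_of_lt hij'
    · simp only [φ, Fin.castLT_castSucc, Fin.succ_pred]
  · rintro ⟨j, i⟩ hij
    have hij' : (i : ℕ) ≤ (j : ℕ) := (Finset.mem_filter.mp hij).2
    obtain ⟨i, rfl⟩ : ∃ i' : Fin (n + 1), i = i'.castSucc :=
      ⟨⟨i, lt_of_le_of_lt hij' j.isLt⟩, rfl⟩
    have h : ∀ α β : Fin 2, cubicalFace F (BoxPlus.δ j.succ β) ≫ cubicalFace F (BoxPlus.δ i α) =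
        cubicalFace F (BoxPlus.δ i.castSucc α) ≫ cubicalFace F (BoxPlus.δ j β) := by
      intro α β
      rw [cubicalFace_comp, cubicalFace_comp, BoxPlus.δ_comp_δ i j hij']
    simp only [φ, Fin.castLT_castSucc, Fin.val_succ, Fin.val_castSucc, Preadditive.zsmul_comp,
      Preadditive.comp_zsmul, Preadditive.sub_comp, Preadditive.comp_sub, h]
    module

/-- The chain complex `C_*(X, F)`. -/
def cubicalComplex {X : PrecubicalSet} (F : HomologicalSystem.{u} X) :
    ChainComplex AddCommGrpCat.{u} ℕ :=
  ChainComplex.of (cubicalChains F) (cubicalD F) (cubicalD_comp F)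

/-- The homology groups `H_k(X, F)` of a precubical set with coefficients in a homological
system. -/
def cubicalHomology {X : PrecubicalSet} (F : HomologicalSystem.{u} X) (k : ℕ) :
    AddCommGrpCat.{u} :=
  (cubicalComplex F).homology k

/-! ## The free commutative monoid and its precubical set of square-free monomials -/

/-- The free commutative monoid `ℕ^n`, written multiplicatively. -/
abbrev FreeCommMonoid (n : ℕ) : Type := Multiplicative (Fin n → ℕ)

/-- The generators `a₁, …, aₙ` of `ℕ^n`. -/
def gen {n : ℕ} (i : Fin n) : FreeCommMonoid n := Multiplicative.ofAdd (Pi.single i 1)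

/-- The square-free monomial `a_{i₁} a_{i₂} ⋯ a_{iₖ}` of a sequence `i₁ < i₂ < ⋯ < iₖ`. -/
def monomial {n k : ℕ} (σ : Fin k ↪o Fin n) : FreeCommMonoid n := ∏ j, gen (σ j)

/-- A square-free monomial has only one increasing sequence of indices. -/
lemma monomial_injective {n k : ℕ} :
    Function.Injective (monomial : (Fin k ↪o Fin n) → FreeCommMonoid n) := by
  have h : ∀ (σ : Fin k ↪o Fin n) (i : Fin n),
      i ∈ Set.range σ ↔ Multiplicative.toAdd (monomial σ) i ≠ 0 := by
    intro σ i
    have h' : Multiplicative.toAdd (monomial σ) i =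
        ∑ j, (Pi.single (σ j) 1 : Fin n → ℕ) i := by
      rw [monomial, toAdd_prod, Finset.sum_apply]; rfl
    rw [h', Ne, Finset.sum_eq_zero_iff, not_forall]
    constructor
    · rintro ⟨j, rfl⟩
      exact ⟨j, by simp⟩
    · rintro ⟨j, hj⟩
      refine ⟨j, ?_⟩
      by_contra hne
      exact hj fun _ => Pi.single_eq_of_ne (fun h => hne h.symm) 1
  intro σ τ hστ
  refine OrderEmbedding.range_inj.mp (Set.ext fun i => ?_)
  rw [h, h, hστ]

/-- Every morphism of `□₊` copies its arguments in the order-preserving way to some coordinates and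
is constant in the others. -/
lemma IsFace.exists_position {m n : ℕ} {f : (Fin m → Fin 2) → (Fin n → Fin 2)} (hf : IsFace f) :
    ∃ e : Fin m ↪o Fin n, (∀ x j, f x (e j) = x j) ∧
      ∀ j, j ∉ Set.range e → ∃ ε, ∀ x, f x j = ε := by
  induction hf with
  | id => exact ⟨RelEmbedding.refl _, fun _ _ => rfl, fun j hj => absurd ⟨j, rfl⟩ hj⟩
  | coface_comp i ε hf ih =>
    obtain ⟨e, h₁, h₂⟩ := ih
    refine ⟨e.trans (Fin.succAboveOrderEmb i), fun x j => ?_, fun j hj => ?_⟩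
    · exact (Fin.insertNth_apply_succAbove (α := fun _ => Fin 2) i ε _ (e j)).trans (h₁ x j)
    · rcases Fin.eq_self_or_eq_succAbove i j with rfl | ⟨j, rfl⟩
      · exact ⟨ε, fun x => Fin.insertNth_apply_same (α := fun _ => Fin 2) _ _ _⟩
      · obtain ⟨ε', h'⟩ := h₂ j (by rintro ⟨l, rfl⟩; exact hj ⟨l, rfl⟩)
        exact ⟨ε', fun x =>
          (Fin.insertNth_apply_succAbove (α := fun _ => Fin 2) i ε _ j).trans (h' x)⟩

namespace BoxPlus

/-- The order embedding by which a morphism of `□₊` copies its arguments into the coordinates of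
its values: `f(x)_{position f j} = x_j`.  For `δᵢ^ε` it is the increasing map that omits `i`. -/
def position {m n : BoxPlus} (f : m ⟶ n) : Fin m.dim ↪o Fin n.dim :=
  f.isFace.exists_position.choose

lemma apply_position {m n : BoxPlus} (f : m ⟶ n) (x : Fin m.dim → Fin 2) (j : Fin m.dim) :
    f.toFun x (position f j) = x j :=
  f.isFace.exists_position.choose_spec.1 x j

lemma exists_const {m n : BoxPlus} (f : m ⟶ n) (j : Fin n.dim) (hj : j ∉ Set.range (position f)) :
    ∃ ε, ∀ x, f.toFun x j = ε :=
  f.isFace.exists_position.choose_spec.2 j hj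

lemma position_unique {m n : BoxPlus} (f : m ⟶ n) (e : Fin m.dim ↪o Fin n.dim)
    (he : ∀ x j, f.toFun x (e j) = x j) : e = position f := by
  refine RelEmbedding.ext fun j => ?_
  by_cases hj : e j ∈ Set.range (position f)
  · obtain ⟨l, hl⟩ := hj
    have h : (Pi.single j 1 : Fin m.dim → Fin 2) l = (Pi.single j 1 : Fin m.dim → Fin 2) j := by
      rw [← apply_position f (Pi.single j 1) l, hl, he]
    obtain rfl : l = j := by
      by_contra hne
      rw [Pi.single_eq_of_ne hne, Pi.single_eq_same] at h
      exact absurd h (by decide)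
    exact hl.symm
  · obtain ⟨ε, hε⟩ := exists_const f _ hj
    have h : (0 : Fin 2) = 1 :=
      ((he (fun _ => 0) j).symm.trans (hε _)).trans ((hε _).symm.trans (he (fun _ => 1) j))
    exact absurd h (by decide)

lemma position_id (n : BoxPlus) : position (𝟙 n) = RelEmbedding.refl _ :=
  (position_unique _ _ fun _ _ => rfl).symm

lemma position_comp {l m n : BoxPlus} (g : l ⟶ m) (f : m ⟶ n) :
    position (g ≫ f) = (position g).trans (position f) :=
  (position_unique _ _ fun x j =>
    (apply_position f (g.toFun x) (position g j)).trans (apply_position g x j)).symm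

lemma position_δ {n : ℕ} (i : Fin (n + 1)) (ε : Fin 2) :
    position (δ i ε) = Fin.succAboveOrderEmb i :=
  (position_unique _ _ fun x j =>
    Fin.insertNth_apply_succAbove (α := fun _ => Fin 2) i ε x j).symm

/-- The coordinates of the values of a morphism of `□₊` that are constantly equal to `ε`. -/
def constCoords {m n : BoxPlus} (f : m ⟶ n) (ε : Fin 2) : Finset (Fin n.dim) :=
  Finset.univ.filter fun j => ∀ x, f.toFun x j = ε

lemma mem_constCoords {m n : BoxPlus} (f : m ⟶ n) (ε : Fin 2) (j : Fin n.dim) :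
    j ∈ constCoords f ε ↔ ∀ x, f.toFun x j = ε := by
  simp [constCoords]

lemma position_notMem_constCoords {m n : BoxPlus} (f : m ⟶ n) (ε : Fin 2) (j : Fin m.dim) :
    position f j ∉ constCoords f ε := by
  rw [mem_constCoords]
  intro h
  have h₀ := (h fun _ => ε + 1).symm.trans (apply_position f _ j)
  revert h₀
  generalize ε = ε'
  revert ε'
  decide

lemma disjoint_constCoords {m n : BoxPlus} (f : m ⟶ n) :
    Disjoint (constCoords f 1) (constCoords f 0) := by
  rw [Finset.disjoint_left]
  intro j h₁ h₀
  rw [mem_constCoords] at h₁ h₀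
  exact absurd ((h₁ 0).symm.trans (h₀ 0)) (by decide)

lemma constCoords_comp {l m n : BoxPlus} (g : l ⟶ m) (f : m ⟶ n) (ε : Fin 2) :
    constCoords (g ≫ f) ε =
      constCoords f ε ∪ (constCoords g ε).map (position f).toEmbedding := by
  ext j
  simp only [Finset.mem_union, Finset.mem_map, mem_constCoords]
  constructor
  · intro h
    by_cases hj : j ∈ Set.range (position f)
    · obtain ⟨i, rfl⟩ := hj
      exact Or.inr ⟨i, fun x => (apply_position f (g.toFun x) i).symm.trans (h x), rfl⟩
    · obtain ⟨ε', h'⟩ := exists_const f j hj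
      have : ε' = ε := (h' _).symm.trans (h 0)
      exact Or.inl fun x => (h' x).trans this
  · rintro (h | ⟨i, h, rfl⟩)
    · exact fun x => h _
    · exact fun x => (apply_position f (g.toFun x) i).trans (h x)

end BoxPlus

/-- The precubical set `T^n_*` of square-free monomials.  A monomial `a_{i₁} ⋯ a_{iₖ}` of
dimension `k` is given by its sequence of indices `i₁ < ⋯ < iₖ`; both faces `∂ₛ^0` and `∂ₛ^1` omit
`a_{iₛ}`. -/
def squarefreeSet (n : ℕ) : PrecubicalSet where
  obj k := Fin k.unop.dim ↪o Fin n
  map f := ↾fun σ => (BoxPlus.position f.unop).trans σ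
  map_id k := by
    refine ConcreteCategory.hom_ext _ _ fun σ => ?_
    change (BoxPlus.position (𝟙 k.unop)).trans σ = σ
    rw [BoxPlus.position_id]
    rfl
  map_comp f g := by
    refine ConcreteCategory.hom_ext _ _ fun σ => ?_
    change (BoxPlus.position (g.unop ≫ f.unop)).trans σ = _
    rw [BoxPlus.position_comp]
    rfl

/-- The property of being a square-free monomial; it defines the full subcategory `𝔉T^n` of the
category of factorizations of `ℕ^n`. -/
def IsSquarefreeMonomial (n : ℕ) : ObjectProperty (MonoidFactorizations (FreeCommMonoid n)) :=
  fun α => ∃ (k : ℕ) (σ : Fin k ↪o Fin n), α = Factorizations.ofElement (monomial σ)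

/-- For `f : 𝕀^m → 𝕀^k` in `□₊` and `a_{i₁} ⋯ a_{iₖ}`, the product of all `a_{iⱼ}` such that the
`j`-th coordinate of `f` is constantly equal to `ε`. -/
def constPart {n : ℕ} {l m : BoxPlus} (f : l ⟶ m) (σ : Fin m.dim ↪o Fin n) (ε : Fin 2) :
    FreeCommMonoid n :=
  ∏ j ∈ BoxPlus.constCoords f ε, gen (σ j)

lemma constPart_id {n : ℕ} {m : BoxPlus} (σ : Fin m.dim ↪o Fin n) (ε : Fin 2) :
    constPart (𝟙 m) σ ε = 1 := by
  refine Finset.prod_eq_one fun j hj => absurd hj ?_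
  have h := BoxPlus.position_notMem_constCoords (𝟙 m) ε j
  rwa [BoxPlus.position_id] at h

lemma constPart_comp {n : ℕ} {k l m : BoxPlus} (g : k ⟶ l) (f : l ⟶ m)
    (σ : Fin m.dim ↪o Fin n) (ε : Fin 2) :
    constPart (g ≫ f) σ ε =
      constPart f σ ε * constPart g ((BoxPlus.position f).trans σ) ε := by
  rw [constPart, BoxPlus.constCoords_comp, Finset.prod_union, Finset.prod_map]
  · rfl
  · rw [Finset.disjoint_right]
    intro j hj
    obtain ⟨i, -, rfl⟩ := Finset.mem_map.mp hj
    exact BoxPlus.position_notMem_constCoords f ε i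

lemma constPart_mul {n : ℕ} {l m : BoxPlus} (f : l ⟶ m) (σ : Fin m.dim ↪o Fin n) :
    constPart f σ 1 * monomial ((BoxPlus.position f).trans σ) * constPart f σ 0 = monomial σ := by
  have h : (Finset.univ : Finset (Fin m.dim)) =
      (BoxPlus.constCoords f 1 ∪ BoxPlus.constCoords f 0) ∪
        Finset.univ.map (BoxPlus.position f).toEmbedding := by
    ext j
    simp only [Finset.mem_univ, Finset.mem_union, Finset.mem_map, true_and, true_iff,
      BoxPlus.mem_constCoords]
    by_cases hj : j ∈ Set.range (BoxPlus.position f)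
    · exact Or.inr hj
    · obtain ⟨ε, hε⟩ := BoxPlus.exists_const f j hj
      fin_cases ε
      · exact Or.inl (Or.inr hε)
      · exact Or.inl (Or.inl hε)
  have hd : Disjoint (BoxPlus.constCoords f 1 ∪ BoxPlus.constCoords f 0)
      (Finset.univ.map (BoxPlus.position f).toEmbedding) := by
    rw [Finset.disjoint_right]
    intro j hj hj'
    obtain ⟨i, -, rfl⟩ := Finset.mem_map.mp hj
    rcases Finset.mem_union.mp hj' with h' | h' <;>
      exact BoxPlus.position_notMem_constCoords f _ i h'
  have h' : monomial σ = constPart f σ 1 * constPart f σ 0 *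
      monomial ((BoxPlus.position f).trans σ) := by
    rw [monomial, h, Finset.prod_union hd, Finset.prod_union (BoxPlus.disjoint_constCoords f),
      Finset.prod_map]
    rfl
  rw [h', mul_right_comm]

lemma constPart_δ_same {n k : ℕ} (i : Fin (k + 1)) (σ : Fin (k + 1) ↪o Fin n) (ε : Fin 2) :
    constPart (BoxPlus.δ i ε) σ ε = gen (σ i) := by
  rw [constPart, Finset.prod_eq_single_of_mem i]
  · rw [BoxPlus.mem_constCoords]
    exact fun x => Fin.insertNth_apply_same (α := fun _ => Fin 2) i ε x
  · intro j hj hne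
    obtain ⟨l, rfl⟩ := Fin.exists_succAbove_eq hne
    have h := BoxPlus.position_notMem_constCoords (BoxPlus.δ i ε) ε l
    rw [BoxPlus.position_δ] at h
    exact absurd hj h

lemma constPart_δ_ne {n k : ℕ} (i : Fin (k + 1)) (σ : Fin (k + 1) ↪o Fin n) {ε ε' : Fin 2}
    (h : ε ≠ ε') : constPart (BoxPlus.δ i ε) σ ε' = 1 := by
  refine Finset.prod_eq_one fun j hj => ?_
  rcases Fin.eq_self_or_eq_succAbove i j with rfl | ⟨l, rfl⟩
  · rw [BoxPlus.mem_constCoords] at hj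
    exact absurd ((Fin.insertNth_apply_same (α := fun _ => Fin 2) _ ε 0).symm.trans (hj 0)) h
  · have h := BoxPlus.position_notMem_constCoords (BoxPlus.δ i ε) ε' l
    rw [BoxPlus.position_δ] at h
    exact absurd hj h

/-- The functor `𝔖 : □₊/T^n_* ⥤ 𝔉T^n`.  It takes a monomial to itself, a morphism given by
`δₛ^0` to `(a_{iₛ}, 1)` and a morphism given by `δₛ^1` to `(1, a_{iₛ})`; so in the value `(x, y)`
at a general morphism `f`, the generators in `x` (in `y`) are those at the coordinates at which `f`
is constantly `0` (constantly `1`). -/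
def monomialFunctor (n : ℕ) :
    Cubes (squarefreeSet n) ⥤ (IsSquarefreeMonomial n).FullSubcategory where
  obj σ := ⟨Factorizations.ofElement (monomial (k := σ.box.dim) σ.cell), _, _, rfl⟩
  map {σ τ} p := ObjectProperty.homMk
    (Factorizations.homOfElements (constPart p.f τ.cell 0) (constPart p.f τ.cell 1)
      (by rw [← p.w]; exact constPart_mul p.f τ.cell))
  map_id σ := by
    refine ObjectProperty.hom_ext _ (Factorizations.hom_ext ?_ ?_)
    · exact constPart_id (m := σ.box) σ.cell 0
    · exact constPart_id (m := σ.box) σ.cell 1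
  map_comp {ρ σ τ} p q := by
    have h : (BoxPlus.position q.f).trans τ.cell = σ.cell := q.w
    refine ObjectProperty.hom_ext _ (Factorizations.hom_ext ?_ ?_)
    · refine (constPart_comp p.f q.f τ.cell 0).trans ?_
      rw [h]
      exact mul_comm (constPart q.f τ.cell 0) (constPart p.f σ.cell 0)
    · refine (constPart_comp p.f q.f τ.cell 1).trans ?_
      rw [h]
      rfl

/-- The homological system `F̄ = F|_{(𝔉T^n)ᵒᵖ} ∘ 𝔖ᵒᵖ` on `T^n_*`. -/
def restrictedSystem {n : ℕ} (F : NaturalSystem.{u} (FreeCommMonoid n)) :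
    HomologicalSystem.{u} (squarefreeSet n) :=
  (monomialFunctor n).op ⋙ (IsSquarefreeMonomial n).ι.op ⋙ F

/-! ## The Koszul-type complex -/

lemma gen_mul_monomial {n k : ℕ} (σ : Fin (k + 1) ↪o Fin n) (s : Fin (k + 1)) :
    gen (σ s) * monomial ((Fin.succAboveOrderEmb s).trans σ) = monomial σ :=
  (Fin.prod_univ_succAbove (fun j => gen (σ j)) s).symm

/-- The morphism `(a_{iₛ}, 1)` from `a_{i₁} ⋯ a_{iₖ}` with `a_{iₛ}` omitted
to `a_{i₁} ⋯ a_{iₖ}`. -/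
def leftInsertion {n k : ℕ} (σ : Fin (k + 1) ↪o Fin n) (s : Fin (k + 1)) :
    Factorizations.ofElement (monomial ((Fin.succAboveOrderEmb s).trans σ)) ⟶
      Factorizations.ofElement (monomial σ) :=
  Factorizations.homOfElements (gen (σ s)) 1 (by rw [one_mul, mul_comm, gen_mul_monomial])

/-- The morphism `(1, a_{iₛ})` from `a_{i₁} ⋯ a_{iₖ}` with `a_{iₛ}` omitted
to `a_{i₁} ⋯ a_{iₖ}`. -/
def rightInsertion {n k : ℕ} (σ : Fin (k + 1) ↪o Fin n) (s : Fin (k + 1)) :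
    Factorizations.ofElement (monomial ((Fin.succAboveOrderEmb s).trans σ)) ⟶
      Factorizations.ofElement (monomial σ) :=
  Factorizations.homOfElements 1 (gen (σ s)) (by rw [mul_one, gen_mul_monomial])

/-- `⨁_{i₁ < ⋯ < iₖ} F(a_{i₁} ⋯ a_{iₖ})`. -/
def koszulChains {n : ℕ} (F : NaturalSystem.{u} (FreeCommMonoid n)) (k : ℕ) :
    AddCommGrpCat.{u} :=
  ∐ fun σ : Fin k ↪o Fin n => F.obj (op (Factorizations.ofElement (monomial σ)))

/-- The inclusion of the summand of a sequence `i₁ < ⋯ < iₖ`. -/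
def koszulι {n : ℕ} (F : NaturalSystem.{u} (FreeCommMonoid n)) {k : ℕ} (σ : Fin k ↪o Fin n) :
    F.obj (op (Factorizations.ofElement (monomial σ))) ⟶ koszulChains F k :=
  Sigma.ι (fun σ : Fin k ↪o Fin n => F.obj (op (Factorizations.ofElement (monomial σ)))) σ

/-- The differential takes `φ` in the summand of `(i₁, …, i_{k+1})` to
`∑ₛ (-1)^s (F(1, a_{iₛ}) φ - F(a_{iₛ}, 1) φ)`, the `s`-th term in the summand
of `(i₁, …, i_{k+1})` with `iₛ` omitted; `1 ≤ s ≤ k + 1`, but here `s` is counted from `0`. -/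
def koszulD {n : ℕ} (F : NaturalSystem.{u} (FreeCommMonoid n)) (k : ℕ) :
    koszulChains F (k + 1) ⟶ koszulChains F k :=
  Sigma.desc fun σ : Fin (k + 1) ↪o Fin n =>
    ∑ s : Fin (k + 1), (-1 : ℤ) ^ ((s : ℕ) + 1) •
      ((F.map (rightInsertion σ s).op - F.map (leftInsertion σ s).op) ≫
        koszulι F ((Fin.succAboveOrderEmb s).trans σ))

lemma homOfElements_koszulι_congr {n : ℕ} (F : NaturalSystem.{u} (FreeCommMonoid n)) {k : ℕ}
    {b x x' y y' : FreeCommMonoid n} {τ τ' : Fin k ↪o Fin n} (hτ : τ = τ') (hx : x = x')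
    (hy : y = y') (h : y * monomial τ * x = b) (h' : y' * monomial τ' * x' = b) :
    F.map (Factorizations.homOfElements x y h).op ≫ koszulι F τ =
      F.map (Factorizations.homOfElements x' y' h').op ≫ koszulι F τ' := by
  subst hτ hx hy
  rfl

lemma ι_koszulD {n : ℕ} (F : NaturalSystem.{u} (FreeCommMonoid n)) {k : ℕ}
    (σ : Fin (k + 1) ↪o Fin n) :
    koszulι F σ ≫ koszulD F k = ∑ s : Fin (k + 1), (-1 : ℤ) ^ ((s : ℕ) + 1) •
      (F.map (rightInsertion σ s).op ≫ koszulι F ((Fin.succAboveOrderEmb s).trans σ) -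
        F.map (leftInsertion σ s).op ≫ koszulι F ((Fin.succAboveOrderEmb s).trans σ)) := by
  simp only [← Preadditive.sub_comp]
  exact Sigma.ι_desc _ _

lemma restrictedSystem_map_ι {n : ℕ} (F : NaturalSystem.{u} (FreeCommMonoid n)) {k l : ℕ}
    (f : (⟨k⟩ : BoxPlus) ⟶ ⟨l⟩) (σ : (squarefreeSet n).obj (op ⟨l⟩)) :
    (restrictedSystem F).map (Cubes.restrict f σ).op ≫
        cubicalι (restrictedSystem F) ((squarefreeSet n).map f.op σ) =
      F.map (Factorizations.homOfElements (constPart f σ 0) (constPart f σ 1)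
        (constPart_mul f σ)).op ≫ koszulι F ((BoxPlus.position f).trans σ) :=
  rfl

lemma leftInsertion_map_ι {n : ℕ} (F : NaturalSystem.{u} (FreeCommMonoid n)) {k : ℕ}
    (σ : Fin (k + 1) ↪o Fin n) (s : Fin (k + 1)) :
    F.map (leftInsertion σ s).op ≫ koszulι F ((Fin.succAboveOrderEmb s).trans σ) =
      (restrictedSystem F).map (Cubes.restrict (X := squarefreeSet n) (BoxPlus.δ s 0) σ).op ≫
        cubicalι (restrictedSystem F) ((squarefreeSet n).map (BoxPlus.δ s 0).op σ) := by
  refine Eq.trans ?_ (restrictedSystem_map_ι F (BoxPlus.δ s 0) σ).symm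
  have h : (Fin.succAboveOrderEmb s).trans σ = (BoxPlus.position (BoxPlus.δ s 0)).trans σ := by
    rw [BoxPlus.position_δ]
  exact homOfElements_koszulι_congr F h (constPart_δ_same s σ 0).symm
    (constPart_δ_ne s σ (by decide)).symm _ _

lemma rightInsertion_map_ι {n : ℕ} (F : NaturalSystem.{u} (FreeCommMonoid n)) {k : ℕ}
    (σ : Fin (k + 1) ↪o Fin n) (s : Fin (k + 1)) :
    F.map (rightInsertion σ s).op ≫ koszulι F ((Fin.succAboveOrderEmb s).trans σ) =
      (restrictedSystem F).map (Cubes.restrict (X := squarefreeSet n) (BoxPlus.δ s 1) σ).op ≫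
        cubicalι (restrictedSystem F) ((squarefreeSet n).map (BoxPlus.δ s 1).op σ) := by
  refine Eq.trans ?_ (restrictedSystem_map_ι F (BoxPlus.δ s 1) σ).symm
  have h : (Fin.succAboveOrderEmb s).trans σ = (BoxPlus.position (BoxPlus.δ s 1)).trans σ := by
    rw [BoxPlus.position_δ]
  exact homOfElements_koszulι_congr F h (constPart_δ_ne s σ (by decide)).symm
    (constPart_δ_same s σ 1).symm _ _

/-- The Koszul-type differential is the differential of `C_*(T^n_*, F̄)`. -/
lemma koszulD_eq {n : ℕ} (F : NaturalSystem.{u} (FreeCommMonoid n)) (k : ℕ) :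
    koszulD F k = cubicalD (restrictedSystem F) k := by
  refine Sigma.hom_ext _ _ fun σ => ?_
  refine (ι_koszulD F σ).trans (Eq.trans ?_ (cubicalι_D (restrictedSystem F) (n := k) σ).symm)
  refine Finset.sum_congr rfl fun s _ => ?_
  rw [leftInsertion_map_ι, rightInsertion_map_ι]
  rfl

lemma koszulD_comp {n : ℕ} (F : NaturalSystem.{u} (FreeCommMonoid n)) (k : ℕ) :
    koszulD F (k + 1) ≫ koszulD F k = 0 := by
  rw [koszulD_eq, koszulD_eq]
  exact cubicalD_comp (restrictedSystem F) k

/-- The Koszul-type chain complex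
`0 ← F(1) ← ⨁_{i₁} F(a_{i₁}) ← ⨁_{i₁ < i₂} F(a_{i₁} a_{i₂}) ← ⋯ ← F(a₁ ⋯ aₙ) ← 0`. -/
def koszulComplex {n : ℕ} (F : NaturalSystem.{u} (FreeCommMonoid n)) :
    ChainComplex AddCommGrpCat.{u} ℕ :=
  ChainComplex.of (koszulChains F) (koszulD F) (koszulD_comp F)

end LeechCubical

end

/-! Both sides are homology theories in the coefficients `F`, and dimension shifting shows that such
theories agree once they agree naturally in degree zero and every `F` is covered by an object
acyclic for both (`nonempty_homology_iso`). In each degree the simplicial complex `C_*` and the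
Koszul-type complex are direct sums of values of `F`, so both are exact in `F`. The covering objects
are the induced functors `e ↦ ⨁_{d ⟶ e} A`.

Degree zero. The cokernel of `C₁ → C₀` is the colimit of `F`. The cokernel in the Koszul-type
complex is `F(1)` modulo the identification of `F(1, a_i)` with `F(a_i, 1)`. A homomorphism out of
`F(1)` respecting these identifications extends uniquely to a cocone: `F(b) ⟶ F(1)` along a
factorization `y * 1 * x = b` becomes independent of the factorization, because generators can be
moved one at a time from `y` to `x` (`factorizationMap_eq`).

Acyclicity for `C_*`. With induced coefficients the summands are indexed by chains `d ⟶ c₀ ⟶ ⋯ ⟶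
cₘ`. Absorbing `d` into the chain, with the identity of `d` as the new coefficient morphism, is an
extra degeneracy (`isZero_catComplex_homology_inducedFunctor`).

Acyclicity for the Koszul-type complex. With induced coefficients it splits over the objects `d`.
The summands for `d` are the factorizations `d = y * a_{i₁} ⋯ a_{iₖ} * x`. By cancellation these are
the `k`-cells, with directions `i₁, …, iₖ` and least vertex `x`, of the box whose side lengths are
the exponents of `d`. The differential becomes the cubical boundary, and a box is contracted one
direction at a time (`exists_latticeD_eq`).

Finally, the Koszul-type complex is the cubical complex of `F̄` itself (`koszulComplex_eq`). -/

noncomputable section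

namespace LeechCubical

/-! ## Comparison of homological functors by dimension shifting -/

section DimensionShifting

variable {A B : Type*} [Category* A] [Abelian A] [Category* B] [Abelian B]

/-- The short complex `0 ⟶ ker p ⟶ P ⟶ F ⟶ 0`. -/
abbrev kernelSequence {P F : A} (p : P ⟶ F) : ShortComplex A :=
  ShortComplex.mk (kernel.ι p) p (kernel.condition p)

lemma kernelSequence_shortExact {P F : A} (p : P ⟶ F) [Epi p] :
    (kernelSequence p).ShortExact where
  exact := ShortComplex.exact_kernel p

variable (C K : A ⥤ ChainComplex B ℕ) [C.PreservesZeroMorphisms] [K.PreservesZeroMorphisms]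

/-- The first homology as the kernel of the map of zeroth homology groups. -/
def homologyOneIso {P F : A} (p : P ⟶ F) (h : ((kernelSequence p).map C).ShortExact)
    (hP : IsZero ((C.obj P).homology 1)) :
    (C.obj F).homology 1 ≅
      kernel ((C ⋙ HomologicalComplex.homologyFunctor B _ 0).map (kernel.ι p)) :=
  -- Since `H₁(P) = 0`, the connecting map `H₁(F) ⟶ H₀(ker p)` is a monomorphism, and exactness at
  -- `H₀(ker p)` makes it a kernel of the next map.
  haveI := h.mono_δ 1 0 rfl hP
  (h.homology_exact₁ 1 0 rfl).fIsKernel.conePointUniqueUpToIso (limit.isLimit _)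

/-- Two exact functors to chain complexes with isomorphic zeroth homology have isomorphic homology
if every object is a quotient of an object that is acyclic for both. -/
theorem nonempty_homology_iso
    (hC : ∀ S : ShortComplex A, S.ShortExact → (S.map C).ShortExact)
    (hK : ∀ S : ShortComplex A, S.ShortExact → (S.map K).ShortExact)
    (e : C ⋙ HomologicalComplex.homologyFunctor B _ 0 ≅
      K ⋙ HomologicalComplex.homologyFunctor B _ 0)
    (hP : ∀ F : A, ∃ (P : A) (p : P ⟶ F), Epi p ∧ ∀ k : ℕ,
      IsZero ((C.obj P).homology (k + 1)) ∧ IsZero ((K.obj P).homology (k + 1)))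
    (k : ℕ) (F : A) : Nonempty ((C.obj F).homology k ≅ (K.obj F).homology k) := by
  induction k generalizing F with
  | zero => exact ⟨e.app F⟩
  | succ k ih =>
    obtain ⟨P, p, hp, hP⟩ := hP F
    have hC' := hC _ (kernelSequence_shortExact p)
    have hK' := hK _ (kernelSequence_shortExact p)
    cases k with
    | zero =>
      -- `H₁` is a kernel of a map between `H₀` groups, so the naturality of `e` is needed here, and
      -- only here. No naturality of the isomorphisms in higher degrees is required, hence
      -- `Nonempty` suffices for the induction.
      exact ⟨homologyOneIso C p hC' (hP 0).1 ≪≫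
        kernel.mapIso _ _ (e.app _) (e.app _) (e.hom.naturality _) ≪≫
          (homologyOneIso K p hK' (hP 0).2).symm⟩
    | succ k =>
      obtain ⟨i⟩ := ih (kernel p)
      -- The homology of `P` vanishes in the two adjacent degrees, so the connecting maps are
      -- isomorphisms, and the induction hypothesis applies to `kernel p`.
      exact ⟨hC'.δIso (k + 2) (k + 1) rfl (hP (k + 1)).1 (hP k).1 ≪≫ i ≪≫
        (hK'.δIso (k + 2) (k + 1) rfl (hP (k + 1)).2 (hP k).2).symm⟩

end DimensionShifting

/-! ## Exactness of the chain complexes in the coefficients -/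

section Sums

variable {D : Type} [SmallCategory D]

/-- The homomorphism `⨁ⱼ F(oⱼ) ⟶ ⨁ⱼ G(oⱼ)` induced by a natural transformation. -/
def sumMap {J : Type} (o : J → D) {F G : D ⥤ AddCommGrpCat.{u}} (α : F ⟶ G) :
    (∐ fun j => F.obj (o j)) ⟶ ∐ fun j => G.obj (o j) :=
  Sigma.desc fun j => α.app (o j) ≫ Sigma.ι (fun j => G.obj (o j)) j

lemma ι_sumMap {J : Type} (o : J → D) {F G : D ⥤ AddCommGrpCat.{u}} (α : F ⟶ G) (j : J) :
    Sigma.ι (fun j => F.obj (o j)) j ≫ sumMap o α =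
      α.app (o j) ≫ Sigma.ι (fun j => G.obj (o j)) j :=
  Sigma.ι_desc _ _

lemma sumMap_id {J : Type} (o : J → D) (F : D ⥤ AddCommGrpCat.{u}) : sumMap o (𝟙 F) = 𝟙 _ :=
  Sigma.hom_ext _ _ fun j => by simp [ι_sumMap]

lemma sumMap_comp {J : Type} (o : J → D) {F G H : D ⥤ AddCommGrpCat.{u}} (α : F ⟶ G)
    (β : G ⟶ H) : sumMap o (α ≫ β) = sumMap o α ≫ sumMap o β :=
  Sigma.hom_ext _ _ fun j => by simp [ι_sumMap, reassoc_of% (@ι_sumMap)]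

lemma sumMap_zero {J : Type} (o : J → D) (F G : D ⥤ AddCommGrpCat.{u}) :
    sumMap o (0 : F ⟶ G) = 0 :=
  Sigma.hom_ext _ _ fun j => by simp [ι_sumMap]

/-- The functor `F ↦ ⨁ⱼ F(oⱼ)`. -/
@[simps]
def sumFunctor {J : Type} (o : J → D) : (D ⥤ AddCommGrpCat.{u}) ⥤ AddCommGrpCat.{u} where
  obj F := ∐ fun j => F.obj (o j)
  map α := sumMap o α
  map_id F := sumMap_id o F
  map_comp α β := sumMap_comp o α β

/-- The sum of the values of `F` at the `oⱼ` as a colimit over a discrete category. -/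
def sumIso {J : Type} (o : J → D) (F : D ⥤ AddCommGrpCat.{u}) :
    (∐ fun j => F.obj (o j)) ≅ colimit (Discrete.functor o ⋙ F) :=
  HasColimit.isoOfNatIso (Discrete.natIso fun j => Iso.refl (F.obj (o j.as)))

lemma ι_sumIso {J : Type} (o : J → D) (F : D ⥤ AddCommGrpCat.{u}) (j : J) :
    Sigma.ι (fun j => F.obj (o j)) j ≫ (sumIso o F).hom =
      colimit.ι (Discrete.functor o ⋙ F) ⟨j⟩ :=
  (HasColimit.isoOfNatIso_ι_hom _ _).trans (Category.id_comp _)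

/-- The functor `F ↦ ⨁ⱼ F(oⱼ)` is the composite of a restriction and of the formation of
colimits. -/
def sumFunctorIso {J : Type} (o : J → D) :
    sumFunctor.{u} o ≅ (Functor.whiskeringLeft _ _ _).obj (Discrete.functor o) ⋙ colim :=
  NatIso.ofComponents (fun F => sumIso o F) (fun {F G} α => by
    refine Sigma.hom_ext _ _ fun j => ?_
    refine ((reassoc_of% (ι_sumMap o α j)) _).trans ?_
    refine Eq.trans ?_ ((reassoc_of% (ι_sumIso o F j)) _).symm
    refine Eq.trans ?_ (ι_colimMap (Functor.whiskerLeft (Discrete.functor o) α) ⟨j⟩).symm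
    exact congrArg (α.app (o j) ≫ ·) (ι_sumIso o G j))

/-- Direct sums of abelian groups are exact: restriction to a family of objects is exact, and so is
the colimit over a discrete category. -/
instance {J : Type} (o : J → D) : PreservesFiniteLimits (sumFunctor.{u} o) :=
  preservesFiniteLimits_of_natIso (sumFunctorIso o).symm

instance {J : Type} (o : J → D) : PreservesFiniteColimits (sumFunctor.{u} o) :=
  preservesFiniteColimits_of_natIso (sumFunctorIso o).symm

instance {J : Type} (o : J → D) : (sumFunctor.{u} o).PreservesZeroMorphisms where
  map_zero F G := sumMap_zero o F G

end Sums

/-! ### Functoriality and exactness of `C_*(C, F)` in `F`. -/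

section Cat

variable {D : Type} [SmallCategory D]

/-- The homomorphism `Cₙ(C, F) ⟶ Cₙ(C, G)` induced by a natural transformation. -/
def catMap {F G : D ⥤ AddCommGrpCat.{u}} (α : F ⟶ G) (m : ℕ) : catChains F m ⟶ catChains G m :=
  sumMap (fun s : ComposableArrows D m => s.obj 0) α

lemma catι_catMap {F G : D ⥤ AddCommGrpCat.{u}} (α : F ⟶ G) {m : ℕ}
    (s : ComposableArrows D m) : catι F s ≫ catMap α m = α.app (s.obj 0) ≫ catι G s :=
  ι_sumMap _ α s

lemma catOperator_naturality {F G : D ⥤ AddCommGrpCat.{u}} (α : F ⟶ G) {l m : ℕ}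
    (φ : Fin (l + 1) →o Fin (m + 1)) :
    catOperator F φ ≫ catMap α l = catMap α m ≫ catOperator G φ := by
  refine catChains_hom_ext fun s => ?_
  rw [reassoc_of% catι_catMap, catι_catOperator, ← Category.assoc, catι_catOperator]
  refine (Category.assoc _ _ _).trans ((congrArg (F.map _ ≫ ·) (catι_catMap α _)).trans ?_)
  exact α.naturality_assoc _ _

/-- The simplicial abelian group `[n] ↦ Cₙ(C, F)` as a functor in `F`. -/
def simplicialReplacementFunctor (D : Type) [SmallCategory D] :
    (D ⥤ AddCommGrpCat.{u}) ⥤ SimplicialObject AddCommGrpCat.{u} where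
  obj F := simplicialReplacement F
  map {F G} α :=
    { app := fun Δ => catMap α Δ.unop.len
      naturality := fun Δ Δ' φ => catOperator_naturality α φ.unop.toOrderHom }
  map_id F := by
    apply NatTrans.ext
    funext Δ
    exact sumMap_id _ F
  map_comp α β := by
    apply NatTrans.ext
    funext Δ
    exact sumMap_comp _ α β

/-- The chain complex `C_*(C, F)` as a functor in `F`. -/
def catFunctor (D : Type) [SmallCategory D] :
    (D ⥤ AddCommGrpCat.{u}) ⥤ ChainComplex AddCommGrpCat.{u} ℕ :=
  simplicialReplacementFunctor D ⋙ AlgebraicTopology.alternatingFaceMapComplex _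

instance : (catFunctor.{u} D).PreservesZeroMorphisms where
  map_zero F G := by
    ext1 m
    exact sumMap_zero _ F G

/-- Exactness is tested in each degree, where the functor is by definition a `sumFunctor`. -/
lemma catFunctor_shortExact (S : ShortComplex (D ⥤ AddCommGrpCat.{u})) (hS : S.ShortExact) :
    (S.map (catFunctor D)).ShortExact :=
  HomologicalComplex.shortExact_of_degreewise_shortExact _ fun m =>
    hS.map_of_exact (sumFunctor fun s : ComposableArrows D m => s.obj 0)

end Cat

/-! ### Functoriality and exactness of the Koszul-type complex in `F`. -/

section Koszul

variable {n : ℕ}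

/-- The homomorphism of the groups of the Koszul-type complexes induced by a natural
transformation. -/
def koszulMap {F G : NaturalSystem.{u} (FreeCommMonoid n)} (α : F ⟶ G) (k : ℕ) :
    koszulChains F k ⟶ koszulChains G k :=
  sumMap (fun σ : Fin k ↪o Fin n => op (Factorizations.ofElement (monomial σ))) α

lemma koszulι_koszulMap {F G : NaturalSystem.{u} (FreeCommMonoid n)} (α : F ⟶ G) {k : ℕ}
    (σ : Fin k ↪o Fin n) :
    koszulι F σ ≫ koszulMap α k = α.app _ ≫ koszulι G σ :=
  ι_sumMap _ α σ

lemma koszulChains_hom_ext {F : NaturalSystem.{u} (FreeCommMonoid n)} {k : ℕ}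
    {A : AddCommGrpCat.{u}} {p q : koszulChains F k ⟶ A}
    (h : ∀ σ : Fin k ↪o Fin n, koszulι F σ ≫ p = koszulι F σ ≫ q) : p = q :=
  Sigma.hom_ext _ _ h

lemma koszulComplex_d (F : NaturalSystem.{u} (FreeCommMonoid n)) (k : ℕ) :
    (koszulComplex F).d (k + 1) k = koszulD F k :=
  ChainComplex.of_d _ _ _

lemma koszulD_naturality {F G : NaturalSystem.{u} (FreeCommMonoid n)} (α : F ⟶ G) (k : ℕ) :
    koszulMap α (k + 1) ≫ koszulD G k = koszulD F k ≫ koszulMap α k := by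
  refine koszulChains_hom_ext fun σ => ?_
  rw [reassoc_of% koszulι_koszulMap, ι_koszulD, ← Category.assoc, ι_koszulD]
  simp only [Preadditive.comp_sum, Preadditive.sum_comp, Preadditive.comp_zsmul,
    Preadditive.zsmul_comp, Preadditive.comp_sub, Preadditive.sub_comp, Category.assoc,
    koszulι_koszulMap, NatTrans.naturality_assoc]

/-- The Koszul-type complex as a functor in the natural system. -/
def koszulFunctor (n : ℕ) :
    NaturalSystem.{u} (FreeCommMonoid n) ⥤ ChainComplex AddCommGrpCat.{u} ℕ where
  obj F := koszulComplex F
  map {F G} α := ChainComplex.ofHom (fun k => koszulMap α k) (fun k => by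
    rw [koszulComplex_d, koszulComplex_d]
    exact koszulD_naturality α k)
  map_id F := by
    ext1 k
    exact sumMap_id _ F
  map_comp α β := by
    ext1 k
    exact sumMap_comp _ α β

instance : (koszulFunctor.{u} n).PreservesZeroMorphisms where
  map_zero F G := by
    ext1 k
    exact sumMap_zero _ F G

lemma koszulFunctor_shortExact (S : ShortComplex (NaturalSystem.{u} (FreeCommMonoid n)))
    (hS : S.ShortExact) : (S.map (koszulFunctor n)).ShortExact :=
  HomologicalComplex.shortExact_of_degreewise_shortExact _ fun k =>
    hS.map_of_exact (sumFunctor fun σ : Fin k ↪o Fin n =>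
      op (Factorizations.ofElement (monomial σ)))

end Koszul

/-! ## Induced functors -/

section Induced

variable {D : Type} [SmallCategory D]

/-- The group `⨁_{d ⟶ e} A`, the sum over all morphisms with target `e`. -/
def inducedSum (A : AddCommGrpCat.{u}) (e : D) : AddCommGrpCat.{u} :=
  AddCommGrpCat.of ((Σ d : D, (d ⟶ e)) →₀ A)

/-- The inclusion of the summand of a morphism. -/
def inducedι (A : AddCommGrpCat.{u}) {d e : D} (f : d ⟶ e) : A ⟶ inducedSum A e :=
  AddCommGrpCat.ofHom (Finsupp.singleAddHom ⟨d, f⟩)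

lemma inducedSum_hom_ext {A : AddCommGrpCat.{u}} {e : D} {B : AddCommGrpCat.{u}}
    {p q : inducedSum A e ⟶ B}
    (h : ∀ {d : D} (f : d ⟶ e), inducedι A f ≫ p = inducedι A f ≫ q) : p = q := by
  ext : 1
  exact Finsupp.addHom_ext fun x a => ConcreteCategory.congr_hom (h x.2) a

/-- The homomorphism from `⨁_{d ⟶ e} A` with given restrictions to the summands. -/
def inducedSumDesc {A : AddCommGrpCat.{u}} {e : D} {B : AddCommGrpCat.{u}}
    (p : ∀ {d : D}, (d ⟶ e) → (A ⟶ B)) : inducedSum A e ⟶ B :=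
  AddCommGrpCat.ofHom (Finsupp.liftAddHom fun x => (p x.2).hom)

lemma inducedι_desc {A : AddCommGrpCat.{u}} {e : D} {B : AddCommGrpCat.{u}}
    (p : ∀ {d : D}, (d ⟶ e) → (A ⟶ B)) {d : D} (f : d ⟶ e) :
    inducedι A f ≫ inducedSumDesc p = p f := by
  ext a
  exact Finsupp.liftAddHom_apply_single (fun x : Σ d : D, (d ⟶ e) => (p x.2).hom) ⟨d, f⟩ a

/-- The homomorphism of sums induced by a morphism `e ⟶ e'`. -/
def inducedMap (A : AddCommGrpCat.{u}) {e e' : D} (φ : e ⟶ e') : inducedSum A e ⟶ inducedSum A e' :=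
  inducedSumDesc fun f => inducedι A (f ≫ φ)

lemma inducedι_map {A : AddCommGrpCat.{u}} {d e e' : D} (f : d ⟶ e) (φ : e ⟶ e') :
    inducedι A f ≫ inducedMap A φ = inducedι A (f ≫ φ) :=
  inducedι_desc _ f

/-- The functor `e ↦ ⨁_{d ⟶ e} A`. -/
def inducedFunctor (D : Type) [SmallCategory D] (A : AddCommGrpCat.{u}) :
    D ⥤ AddCommGrpCat.{u} where
  obj e := inducedSum A e
  map φ := inducedMap A φ
  map_id e := inducedSum_hom_ext fun f => by rw [inducedι_map]; simp
  map_comp φ ψ := inducedSum_hom_ext fun f => by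
    rw [inducedι_map, reassoc_of% inducedι_map, inducedι_map, Category.assoc]

/-- The canonical map from an induced functor onto `F`. -/
def inducedDesc (F : D ⥤ AddCommGrpCat.{u}) :
    inducedFunctor D (AddCommGrpCat.of (∀ d, F.obj d)) ⟶ F where
  app e := inducedSumDesc fun {d} f => AddCommGrpCat.ofHom (Pi.evalAddMonoidHom _ d) ≫ F.map f
  naturality e e' φ := inducedSum_hom_ext fun f => by
    change inducedι _ f ≫ inducedMap _ φ ≫ _ = inducedι _ f ≫ inducedSumDesc _ ≫ F.map φ
    rw [reassoc_of% inducedι_map, inducedι_desc, reassoc_of% inducedι_desc, F.map_comp,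
      Category.assoc]

/-- An element of `F(e)` comes from the summand of the identity of `e`, as the image of the family
concentrated at `e`. Taking the product of all values of `F` as coefficients lets one group `A`
serve every source `d`, which keeps the induced functors free of dependent coefficients. -/
instance (F : D ⥤ AddCommGrpCat.{u}) : Epi (inducedDesc F) := by
  rw [NatTrans.epi_iff_epi_app]
  intro e
  rw [AddCommGrpCat.epi_iff_surjective]
  intro x
  classical
  refine ⟨(inducedι (AddCommGrpCat.of (∀ d, F.obj d)) (𝟙 e)).hom (Pi.single e x), ?_⟩
  have h := inducedι_desc (A := AddCommGrpCat.of (∀ d, F.obj d))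
    (fun {d} f => AddCommGrpCat.ofHom (Pi.evalAddMonoidHom _ d) ≫ F.map f) (𝟙 e)
  refine (ConcreteCategory.congr_hom h (Pi.single e x)).trans ?_
  simp

end Induced

/-! ## Acyclicity of induced functors for the homology of categories -/

/-- On a cycle the term through `h'` vanishes, so the cycle is the boundary of its image under `h`.
The homotopy identity is needed in the single degree `k + 1` only. -/
lemma isZero_homology_of_contraction (X : ChainComplex AddCommGrpCat.{u} ℕ) (k : ℕ)
    (h : X.X (k + 1) ⟶ X.X (k + 2)) (h' : X.X k ⟶ X.X (k + 1))
    (H : h ≫ X.d (k + 2) (k + 1) + X.d (k + 1) k ≫ h' = 𝟙 _) : IsZero (X.homology (k + 1)) := by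
  rw [← HomologicalComplex.exactAt_iff_isZero_homology,
    HomologicalComplex.exactAt_iff' X (k + 2) (k + 1) k (by simp) (by simp),
    ShortComplex.ab_exact_iff]
  intro x hx
  refine ⟨h.hom x, ?_⟩
  have H' : (X.d (k + 2) (k + 1)).hom (h.hom x) + h'.hom ((X.d (k + 1) k).hom x) = x :=
    ConcreteCategory.congr_hom H x
  have hx' : (X.d (k + 1) k).hom x = 0 := hx
  rw [hx', map_zero, add_zero] at H'
  exact H'

open Simplicial in
-- The face `0` after `h` contributes the identity. The face `i + 1` after `h` cancels the face `i`
-- followed by `h'`, since their signs are opposite.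
lemma isZero_homology_of_extraDegeneracy (X : SimplicialObject AddCommGrpCat.{u}) (k : ℕ)
    (h : X _⦋k + 1⦌ ⟶ X _⦋k + 2⦌) (h' : X _⦋k⦌ ⟶ X _⦋k + 1⦌) (h₀ : h ≫ X.δ 0 = 𝟙 _)
    (H : ∀ i : Fin (k + 2), h ≫ X.δ i.succ = X.δ i ≫ h') :
    IsZero (((AlgebraicTopology.alternatingFaceMapComplex _).obj X).homology (k + 1)) := by
  refine isZero_homology_of_contraction _ k h h' ?_
  rw [AlgebraicTopology.alternatingFaceMapComplex_obj_d,
    AlgebraicTopology.alternatingFaceMapComplex_obj_d]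
  change h ≫ (∑ i : Fin (k + 3), (-1 : ℤ) ^ (i : ℕ) • X.δ i) +
    (∑ i : Fin (k + 2), (-1 : ℤ) ^ (i : ℕ) • X.δ i) ≫ h' = 𝟙 (X _⦋k + 1⦌)
  rw [Fin.sum_univ_succ]
  simp only [Preadditive.comp_add, Preadditive.comp_sum, Preadditive.sum_comp,
    Preadditive.comp_zsmul, Preadditive.zsmul_comp, H, h₀, Fin.val_succ, pow_succ, mul_neg, mul_one,
    neg_smul, Preadditive.comp_neg]
  simp

section

variable {D : Type} [SmallCategory D]

/-- The summand of `Cₘ(D, ⨁ A)` of a chain and of a morphism to its first object. -/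
def inducedCatι (A : AddCommGrpCat.{u}) {m : ℕ} (s : ComposableArrows D m) {d : D}
    (f : d ⟶ s.obj 0) : A ⟶ catChains (inducedFunctor D A) m :=
  inducedι A f ≫ catι (inducedFunctor D A) s

lemma inducedCat_hom_ext {A : AddCommGrpCat.{u}} {m : ℕ} {B : AddCommGrpCat.{u}}
    {p q : catChains (inducedFunctor D A) m ⟶ B}
    (h : ∀ (s : ComposableArrows D m) {d : D} (f : d ⟶ s.obj 0),
      inducedCatι A s f ≫ p = inducedCatι A s f ≫ q) : p = q :=
  catChains_hom_ext fun s => inducedSum_hom_ext fun f =>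
    (Category.assoc _ _ _).symm.trans ((h s f).trans (Category.assoc _ _ _))

/-- The type of the coefficient morphism depends on the chain, hence the heterogeneous equality. -/
lemma inducedCatι_congr {A : AddCommGrpCat.{u}} {m : ℕ} {s t : ComposableArrows D m} {d : D}
    {f : d ⟶ s.obj 0} {g : d ⟶ t.obj 0} (h : s = t) (hfg : f ≍ g) :
    inducedCatι A s f = inducedCatι A t g := by
  subst h
  rw [eq_of_heq hfg]

/-- With induced coefficients an operator merely relabels the summands, so the construction of the
contraction reduces to the combinatorics of chains `d ⟶ c₀ ⟶ ⋯ ⟶ cₘ`. -/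
lemma inducedCatι_operator (A : AddCommGrpCat.{u}) {l m : ℕ} (s : ComposableArrows D m) {d : D}
    (f : d ⟶ s.obj 0) (φ : Fin (l + 1) →o Fin (m + 1)) :
    inducedCatι A s f ≫ catOperator (inducedFunctor D A) φ =
      inducedCatι A (s.whiskerLeft φ.monotone.functor)
        (f ≫ s.map (homOfLE (Fin.zero_le (φ 0)))) := by
  refine (Category.assoc _ _ _).trans ?_
  refine (congrArg (inducedι A f ≫ ·) (catι_catOperator _ φ s)).trans ?_
  exact (reassoc_of% inducedι_map) f _ _

/-- The chain `d ⟶ c₀ ⟶ ⋯ ⟶ cₘ`. -/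
def consChain {m : ℕ} (s : ComposableArrows D m) {d : D} (f : d ⟶ s.obj 0) :
    ComposableArrows D (m + 1) :=
  s.precomp f

/-- The identity of the first object of a chain `d ⟶ c₀ ⟶ ⋯ ⟶ cₘ`. -/
def consChainHead {m : ℕ} (s : ComposableArrows D m) {d : D} (f : d ⟶ s.obj 0) :
    d ⟶ (consChain s f).obj 0 :=
  𝟙 d

/-- The contraction takes the summand of a chain `c₀ ⟶ ⋯ ⟶ cₘ` and of a morphism `d ⟶ c₀` to the
summand of `d ⟶ c₀ ⟶ ⋯ ⟶ cₘ` and of the identity of `d`. -/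
def inducedCatContraction (A : AddCommGrpCat.{u}) (m : ℕ) :
    catChains (inducedFunctor D A) m ⟶ catChains (inducedFunctor D A) (m + 1) :=
  Sigma.desc fun s : ComposableArrows D m =>
    inducedSumDesc fun {_} f => inducedCatι A (consChain s f) (consChainHead s f)

lemma inducedCatι_contraction (A : AddCommGrpCat.{u}) {m : ℕ} (s : ComposableArrows D m) {d : D}
    (f : d ⟶ s.obj 0) : inducedCatι A s f ≫ inducedCatContraction A m =
      inducedCatι A (consChain s f) (consChainHead s f) := by
  refine (Category.assoc _ _ _).trans ?_
  refine (congrArg (inducedι A f ≫ ·) (Sigma.ι_desc _ s)).trans ?_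
  exact inducedι_desc _ f

lemma consChain_map_succ {m : ℕ} (s : ComposableArrows D m) {d : D} (f : d ⟶ s.obj 0)
    (j : Fin (m + 1)) : (consChain s f).map (homOfLE (Fin.zero_le j.succ)) =
      f ≫ s.map (homOfLE (Fin.zero_le j)) := by
  obtain ⟨j, hj⟩ := j
  -- `precomp` is defined by cases on the numerical value of the index. At `0` an identity of the
  -- chain `s` has to be removed, and beyond that both sides agree by computation.
  cases j with
  | zero => exact ((congrArg (f ≫ ·) (s.map_id 0)).trans (Category.comp_id f)).symm
  | succ j => rfl

/-- The extension of a monotone map by `0 ↦ 0`. -/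
def liftOrderHom {l m : ℕ} (φ : Fin (l + 1) →o Fin (m + 1)) : Fin (l + 2) →o Fin (m + 2) where
  toFun := Fin.cons 0 fun i => (φ i).succ
  monotone' := by
    intro i j h
    induction i using Fin.cases with
    | zero => exact Fin.zero_le _
    | succ i =>
      induction j using Fin.cases with
      | zero => exact absurd h (by simp)
      | succ j => exact Fin.succ_le_succ_iff.mpr (φ.monotone (Fin.succ_le_succ_iff.mp h))

lemma consChain_whiskerLeft {l m : ℕ} (φ : Fin (l + 1) →o Fin (m + 1)) (s : ComposableArrows D m)
    {d : D} (f : d ⟶ s.obj 0) :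
    (consChain s f).whiskerLeft (liftOrderHom φ).monotone.functor =
      consChain (s.whiskerLeft φ.monotone.functor) (f ≫ s.map (homOfLE (Fin.zero_le (φ 0)))) := by
  refine ComposableArrows.ext (Fin.cases rfl fun _ => rfl) fun i hi => ?_
  cases i with
  | zero =>
    exact (consChain_map_succ s f (φ 0)).trans
      ((Category.id_comp (obj := D) _).trans (Category.comp_id (obj := D) _)).symm
  | succ i => exact ((Category.id_comp (obj := D) _).trans (Category.comp_id (obj := D) _)).symm

/-- An operator that fixes the added first vertex leaves the coefficient morphism equal to the
identity of `d`, so it acts only on the old part of the chain. Applied to a coface, this yields all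
the identities of an extra degeneracy except the one for the face `0`. -/
lemma contraction_operator (A : AddCommGrpCat.{u}) {l m : ℕ} (φ : Fin (l + 1) →o Fin (m + 1)) :
    inducedCatContraction A m ≫ catOperator (inducedFunctor D A) (liftOrderHom φ) =
      catOperator (inducedFunctor D A) φ ≫ inducedCatContraction A l := by
  refine inducedCat_hom_ext fun s {d} f => ?_
  rw [← Category.assoc, inducedCatι_contraction, inducedCatι_operator, ← Category.assoc,
    inducedCatι_operator, inducedCatι_contraction]
  refine inducedCatι_congr (consChain_whiskerLeft φ s f) ?_
  exact heq_of_eq ((Category.id_comp (obj := D) _).trans ((consChain s f).map_id 0))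

/-- Omitting the added vertex composes the identity of `d` with `d ⟶ c₀`, which restores the
original coefficient morphism. -/
lemma contraction_succ (A : AddCommGrpCat.{u}) (m : ℕ) :
    inducedCatContraction A m ≫ catOperator (inducedFunctor D A)
      (Fin.succOrderEmb (m + 1)).toOrderHom = 𝟙 _ := by
  refine inducedCat_hom_ext fun s {d} f => ?_
  rw [← Category.assoc, inducedCatι_contraction, inducedCatι_operator, Category.comp_id]
  exact inducedCatι_congr rfl (heq_of_eq (Category.id_comp f))

lemma isZero_catComplex_homology_inducedFunctor (A : AddCommGrpCat.{u}) (k : ℕ) :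
    IsZero (((catFunctor D).obj (inducedFunctor D A)).homology (k + 1)) := by
  have h₀ : inducedCatContraction A (k + 1) ≫
      (simplicialReplacement (inducedFunctor D A)).δ 0 = 𝟙 _ :=
    contraction_succ A (k + 1)
  have h : ∀ i : Fin (k + 2), inducedCatContraction A (k + 1) ≫
      (simplicialReplacement (inducedFunctor D A)).δ i.succ =
        (simplicialReplacement (inducedFunctor D A)).δ i ≫ inducedCatContraction A k := by
    intro i
    refine Eq.trans ?_ (contraction_operator (D := D) A (SimplexCategory.δ i).toOrderHom)
    refine congrArg (fun φ => inducedCatContraction A (k + 1) ≫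
      catOperator (inducedFunctor D A) φ) ?_
    -- The extension of the coface `δ i` by `0 ↦ 0` is `δ i.succ`.
    refine OrderHom.ext _ _ (funext (Fin.cases ?_ fun j => ?_))
    · exact Fin.succ_succAbove_zero i
    · exact Fin.succ_succAbove_succ i j
  exact isZero_homology_of_extraDegeneracy _ k _ _ h₀ h

end

/-! ## The zeroth homology groups -/

section ZerothHomology

variable {n : ℕ}

lemma mem_of_gen_mem (S : Submonoid (FreeCommMonoid n)) (h : ∀ i, gen i ∈ S)
    (z : FreeCommMonoid n) : z ∈ S := by
  have hz : z = ∏ i, gen i ^ Multiplicative.toAdd z i := by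
    apply Multiplicative.toAdd.injective
    funext i
    simp [gen, toAdd_prod, Finset.sum_apply, Pi.single_apply]
  rw [hz]
  exact S.prod_mem fun i _ => S.pow_mem (h i) _

variable (F : NaturalSystem.{u} (FreeCommMonoid n)) {A : AddCommGrpCat.{u}}

/-- The composite of a homomorphism on `F(1)` with the homomorphism `F(b) ⟶ F(1)` given by a
factorization of `b`. -/
def factorizationMap (q : koszulChains F 0 ⟶ A) (τ : Fin 0 ↪o Fin n) {b : FreeCommMonoid n}
    (x y : FreeCommMonoid n) (h : y * monomial τ * x = b) :
    F.obj (op (Factorizations.ofElement b)) ⟶ A :=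
  F.map (Factorizations.homOfElements x y h).op ≫ koszulι F τ ≫ q

lemma map_factorizationMap (q : koszulChains F 0 ⟶ A) (τ : Fin 0 ↪o Fin n)
    {b c : FreeCommMonoid n} (x y : FreeCommMonoid n) (h : y * monomial τ * x = b)
    (v w : FreeCommMonoid n) (hc : w * b * v = c) (h' : w * y * monomial τ * (x * v) = c) :
    F.map (Factorizations.homOfElements v w hc).op ≫ factorizationMap F q τ x y h =
      factorizationMap F q τ (x * v) (w * y) h' := by
  rw [factorizationMap, factorizationMap, ← Category.assoc, ← F.map_comp]
  rfl

/-- The boundary of the summand of the one-term sequence `i` identifies `F(1, a_i)` with `F(a_i, 1)`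
after `q`. Precomposition with `F(x, y)` turns this into moving `a_i` from one outer factor to the
other. -/
lemma factorizationMap_gen (q : koszulChains F 0 ⟶ A) (hq : koszulD F 0 ≫ q = 0)
    (τ : Fin 0 ↪o Fin n) {b : FreeCommMonoid n} (i : Fin n) (x y : FreeCommMonoid n)
    (h : y * gen i * monomial τ * x = b) (h' : y * monomial τ * (x * gen i) = b) :
    factorizationMap F q τ x (y * gen i) h = factorizationMap F q τ (x * gen i) y h' := by
  let σ : Fin 1 ↪o Fin n := OrderEmbedding.ofStrictMono (fun _ => i) (Subsingleton.strictMono _)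
  obtain rfl : (Fin.succAboveOrderEmb 0).trans σ = τ := RelEmbedding.ext fun j => j.elim0
  have h₀ : koszulι F σ ≫ koszulD F 0 ≫ q = 0 := by rw [hq, comp_zero]
  rw [← Category.assoc, ι_koszulD, Fin.sum_univ_one, Preadditive.zsmul_comp] at h₀
  have h₁ : F.map (rightInsertion σ 0).op ≫ koszulι F ((Fin.succAboveOrderEmb 0).trans σ) ≫ q =
      F.map (leftInsertion σ 0).op ≫ koszulι F ((Fin.succAboveOrderEmb 0).trans σ) ≫ q := by
    -- The sign `(-1)^1` reverses the difference in `h₀`, so the equation comes out with its sides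
    -- exchanged.
    refine Eq.symm ?_
    simpa [sub_eq_zero] using h₀
  have hb : y * monomial σ * x = b := by
    rw [← h, ← gen_mul_monomial σ 0]
    simp only [mul_assoc]
    rfl
  have h₂ := congrArg (F.map (Factorizations.homOfElements x y hb).op ≫ ·) h₁
  simp only [← Category.assoc, ← F.map_comp] at h₂
  simp only [Category.assoc] at h₂
  refine Eq.trans ?_ (h₂.trans ?_)
  · refine congrArg (fun φ => F.map φ ≫ koszulι F _ ≫ q) (Quiver.Hom.unop_inj ?_)
    exact Factorizations.hom_ext (show x = 1 * x from (one_mul x).symm) rfl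
  · refine congrArg (fun φ => F.map φ ≫ koszulι F _ ≫ q) (Quiver.Hom.unop_inj ?_)
    exact Factorizations.hom_ext (mul_comm (gen i) x) (mul_one y)

/-- The elements that can be moved across in every factorization form a submonoid, and it contains
the generators. The quantification over `b`, `x` and `y` belongs inside the submonoid, because a
product is moved in two steps with different outer factors. -/
lemma factorizationMap_mul (q : koszulChains F 0 ⟶ A) (hq : koszulD F 0 ≫ q = 0)
    (τ : Fin 0 ↪o Fin n) (z : FreeCommMonoid n) : ∀ {b : FreeCommMonoid n} (x y : FreeCommMonoid n)
      (h : y * z * monomial τ * x = b) (h' : y * monomial τ * (x * z) = b),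
      factorizationMap F q τ x (y * z) h = factorizationMap F q τ (x * z) y h' := by
  let S : Submonoid (FreeCommMonoid n) :=
    { carrier := {z | ∀ {b : FreeCommMonoid n} (x y : FreeCommMonoid n)
        (h : y * z * monomial τ * x = b) (h' : y * monomial τ * (x * z) = b),
        factorizationMap F q τ x (y * z) h = factorizationMap F q τ (x * z) y h'}
      one_mem' := fun x y h h' => by congr 1
      mul_mem' := fun {z w} hz hw b x y h h' => by
        have h₁ : y * z * monomial τ * (x * w) = b := by rw [← h']; ac_rfl
        have h₂ : y * z * w * monomial τ * x = b := by rw [← h]; ac_rfl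
        have h₃ : y * monomial τ * (x * w * z) = b := by rw [← h']; ac_rfl
        have := (hw x (y * z) h₂ h₁).trans (hz (x * w) y h₁ h₃)
        refine Eq.trans ?_ (this.trans ?_)
        · congr 1; ac_rfl
        · congr 1; ac_rfl }
  intro b
  exact mem_of_gen_mem S (fun i b x y h h' => factorizationMap_gen F q hq τ i x y h h') z

/-- Moving all of `y` across replaces the factorization by `(x * y, 1)`, and cancellation shows that
`x * y` is determined by `b`. -/
lemma factorizationMap_eq (q : koszulChains F 0 ⟶ A) (hq : koszulD F 0 ≫ q = 0)
    (τ : Fin 0 ↪o Fin n) {b : FreeCommMonoid n} (x y x' y' : FreeCommMonoid n)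
    (h : y * monomial τ * x = b) (h' : y' * monomial τ * x' = b) :
    factorizationMap F q τ x y h = factorizationMap F q τ x' y' h' := by
  have key : ∀ (x y : FreeCommMonoid n) (h : y * monomial τ * x = b)
      (h₁ : 1 * monomial τ * (x * y) = b),
      factorizationMap F q τ x y h = factorizationMap F q τ (x * y) 1 h₁ := by
    intro x y h h₁
    refine Eq.trans ?_ (factorizationMap_mul F q hq τ y x 1 (by rw [← h, one_mul]) h₁)
    congr 1
    exact (one_mul y).symm
  have h₁ : 1 * monomial τ * (x * y) = b := by rw [← h, one_mul]; ac_rfl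
  have h₂ : 1 * monomial τ * (x' * y') = b := by rw [← h', one_mul]; ac_rfl
  rw [key x y h h₁, key x' y' h' h₂]
  congr 1
  rw [one_mul] at h₁ h₂
  exact mul_left_cancel (h₁.trans h₂.symm)

/-- The group `F(1)` occurs in `koszulChains F 0` as `F(monomial τ)`, so factorizations are stated
around `monomial τ`. This equation then enters only identities between elements of the monoid, and
no transport of groups is needed. -/
lemma monomial_zero (τ : Fin 0 ↪o Fin n) : monomial τ = 1 := Finset.prod_empty

/-- The homomorphism `F(b) ⟶ F(1) ⟶ A` given by the factorization `1 * 1 * b` of `b`. -/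
def elementMap (q : koszulChains F 0 ⟶ A) (τ : Fin 0 ↪o Fin n) (b : FreeCommMonoid n) :
    F.obj (op (Factorizations.ofElement b)) ⟶ A :=
  factorizationMap F q τ b 1 (by rw [monomial_zero, one_mul, one_mul])

/-- This is the cocone condition: a morphism `b ⟶ c` carries a factorization of `b` to one of `c`,
and all factorizations of `c` give the same homomorphism. -/
lemma map_elementMap (q : koszulChains F 0 ⟶ A) (hq : koszulD F 0 ≫ q = 0) (τ : Fin 0 ↪o Fin n)
    {b c : FreeCommMonoid n} (φ : Factorizations.ofElement b ⟶ Factorizations.ofElement c) :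
    F.map φ.op ≫ elementMap F q τ b = elementMap F q τ c :=
  have h : (show FreeCommMonoid n from φ.g) * 1 * monomial τ *
      (b * show FreeCommMonoid n from φ.f) = c := by
    rw [monomial_zero, mul_one, mul_one, ← mul_assoc]
    exact φ.w
  (map_factorizationMap F q τ _ _ _ φ.f φ.g φ.w h).trans
    (factorizationMap_eq F q hq τ _ _ _ _ _ _)

lemma elementMap_monomial (q : koszulChains F 0 ⟶ A) (hq : koszulD F 0 ≫ q = 0)
    (τ : Fin 0 ↪o Fin n) : elementMap F q τ (monomial τ) = koszulι F τ ≫ q := by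
  refine (factorizationMap_eq F q hq τ _ _ 1 1 _ (by rw [one_mul, mul_one])).trans ?_
  exact (congrArg (· ≫ koszulι F τ ≫ q) (F.map_id _)).trans (Category.id_comp _)

lemma elementMap_comp (q : koszulChains F 0 ⟶ A) (τ : Fin 0 ↪o Fin n) (b : FreeCommMonoid n)
    {B : AddCommGrpCat.{u}} (r : A ⟶ B) :
    elementMap F q τ b ≫ r = elementMap F (q ≫ r) τ b := by
  simp only [elementMap, factorizationMap, Category.assoc]

/-- The homomorphism from `C₀` to `A` with components `F(b) ⟶ F(1) ⟶ A`. -/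
def catDesc (q : koszulChains F 0 ⟶ A) (τ : Fin 0 ↪o Fin n) : catChains F 0 ⟶ A :=
  Sigma.desc fun s => elementMap F q τ (s.obj 0).unop.arrow

lemma catι_catDesc (q : koszulChains F 0 ⟶ A) (τ : Fin 0 ↪o Fin n)
    (s : ComposableArrows (MonoidFactorizations (FreeCommMonoid n))ᵒᵖ 0) :
    catι F s ≫ catDesc F q τ = elementMap F q τ (s.obj 0).unop.arrow :=
  Sigma.ι_desc _ _

end ZerothHomology

/-! ### Degrees zero and one of `C_*(C, F)`: the cokernel as a colimit. -/

section CatZero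

variable {D : Type} [SmallCategory D] (F : D ⥤ AddCommGrpCat.{u}) {A : AddCommGrpCat.{u}}

/-- The differential of `C_*(C, F)`. -/
def catD (m : ℕ) : catChains F (m + 1) ⟶ catChains F m :=
  ∑ i : Fin (m + 2), (-1 : ℤ) ^ (i : ℕ) • catOperator F (SimplexCategory.δ i).toOrderHom

lemma catComplex_d (m : ℕ) : (catComplex F).d (m + 1) m = catD F m :=
  AlgebraicTopology.AlternatingFaceMapComplex.obj_d_eq _ _

/-- The inclusion of the summand of an object. -/
def catPoint (c : D) : F.obj c ⟶ catChains F 0 := catι F (ComposableArrows.mk₀ c)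

lemma catι_eq_catPoint (s : ComposableArrows D 0) : catι F s = catPoint F (s.obj 0) := by
  obtain ⟨c, rfl⟩ := ComposableArrows.mk₀_surjective s
  rfl

/-- The inclusion of the summand of a morphism. -/
def catEdge {c c' : D} (φ : c ⟶ c') : F.obj c ⟶ catChains F 1 := catι F (ComposableArrows.mk₁ φ)

lemma catEdge_d {c c' : D} (φ : c ⟶ c') :
    catEdge F φ ≫ catD F 0 = F.map φ ≫ catPoint F c' - catPoint F c := by
  have h₀ : catEdge F φ ≫ catOperator F (SimplexCategory.δ 0).toOrderHom =
      F.map φ ≫ catPoint F c' :=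
    (catι_catOperator _ _ _).trans (congrArg (F.map φ ≫ ·) (catι_eq_catPoint F _))
  have h₁ : catEdge F φ ≫ catOperator F (SimplexCategory.δ 1).toOrderHom = catPoint F c :=
    (catι_catOperator _ _ _).trans ((congrArg₂ (· ≫ ·) (F.map_id c) (catι_eq_catPoint F _)).trans
      (Category.id_comp _))
  have h₂ : catD F 0 = catOperator F (SimplexCategory.δ 0).toOrderHom -
      catOperator F (SimplexCategory.δ 1).toOrderHom := by
    refine (Fin.sum_univ_two _).trans ?_
    simp [sub_eq_add_neg]
  rw [h₂, Preadditive.comp_sub, h₀, h₁]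

/-- Together with `catD_comp_eq_zero` this says that homomorphisms out of the cokernel of `catD F 0`
are the cocones under `F`. -/
lemma map_catPoint {q : catChains F 0 ⟶ A} (hq : catD F 0 ≫ q = 0) {c c' : D}
    (φ : c ⟶ c') : F.map φ ≫ catPoint F c' ≫ q = catPoint F c ≫ q := by
  have h : catEdge F φ ≫ catD F 0 ≫ q = 0 := by rw [hq, comp_zero]
  rw [← Category.assoc, catEdge_d, Preadditive.sub_comp, Category.assoc] at h
  exact sub_eq_zero.mp h

lemma catD_comp_eq_zero {q : catChains F 0 ⟶ A}
    (hq : ∀ {c c' : D} (φ : c ⟶ c'), F.map φ ≫ catPoint F c' ≫ q = catPoint F c ≫ q) :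
    catD F 0 ≫ q = 0 := by
  refine catChains_hom_ext fun s => ?_
  obtain ⟨c, c', φ, rfl⟩ := ComposableArrows.mk₁_surjective s
  change catEdge F φ ≫ catD F 0 ≫ q = catEdge F φ ≫ 0
  rw [← Category.assoc, catEdge_d, Preadditive.sub_comp, Category.assoc, hq, sub_self, comp_zero]

end CatZero

/-! ### The natural isomorphism in degree zero. -/

section Comparison

variable {n : ℕ} (F : NaturalSystem.{u} (FreeCommMonoid n))

/-- The sequence of length `0`. -/
def emptySequence (n : ℕ) : Fin 0 ↪o Fin n := Fin.castLEOrderEmb (Nat.zero_le n)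

/-- The inclusion of `F(1)` into `C₀`. -/
def koszulToCat : koszulChains F 0 ⟶ catChains F 0 :=
  Sigma.desc fun τ : Fin 0 ↪o Fin n => catPoint F (op (Factorizations.ofElement (monomial τ)))

lemma koszulι_koszulToCat (τ : Fin 0 ↪o Fin n) : koszulι F τ ≫ koszulToCat F =
    catPoint F (op (Factorizations.ofElement (monomial τ))) :=
  Sigma.ι_desc _ _

/-- Both insertions of a generator `a_i` are morphisms of the index category, so by the cocone
condition the two terms equal the component of `q` at `a_i` and cancel. -/
lemma koszulD_koszulToCat {A : AddCommGrpCat.{u}} {q : catChains F 0 ⟶ A}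
    (hq : catD F 0 ≫ q = 0) : koszulD F 0 ≫ koszulToCat F ≫ q = 0 := by
  refine koszulChains_hom_ext fun σ => ?_
  rw [← Category.assoc, ι_koszulD, Fin.sum_univ_one, Preadditive.zsmul_comp, Preadditive.sub_comp]
  simp only [Category.assoc]
  rw [← Category.assoc (koszulι F _), koszulι_koszulToCat, map_catPoint F hq, map_catPoint F hq]
  simp

/-- The projection of `C₀` onto its quotient by the image of the differential. -/
def catP : catChains F 0 ⟶ (catComplex F).opcycles 0 := (catComplex F).pOpcycles 0

instance : Epi (catP F) := inferInstanceAs (Epi ((catComplex F).pOpcycles 0))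

lemma catD_catP : catD F 0 ≫ catP F = 0 := by
  rw [← catComplex_d]
  exact (catComplex F).d_pOpcycles 1 0

/-- The projection of `F(1)` onto its quotient by the image of the differential. -/
def koszulP : koszulChains F 0 ⟶ (koszulComplex F).opcycles 0 := (koszulComplex F).pOpcycles 0

instance : Epi (koszulP F) := inferInstanceAs (Epi ((koszulComplex F).pOpcycles 0))

lemma koszulD_koszulP : koszulD F 0 ≫ koszulP F = 0 := by
  rw [← koszulComplex_d]
  exact (koszulComplex F).d_pOpcycles 1 0

/-- The homomorphism from the quotient of `F(1)` to the quotient of `C₀`. -/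
def opcyclesMap : (koszulComplex F).opcycles 0 ⟶ (catComplex F).opcycles 0 :=
  (koszulComplex F).descOpcycles (koszulToCat F ≫ catP F) 1 (by simp) (by
    rw [koszulComplex_d]
    exact koszulD_koszulToCat F (catD_catP F))

lemma koszulP_opcyclesMap : koszulP F ≫ opcyclesMap F = koszulToCat F ≫ catP F :=
  (koszulComplex F).p_descOpcycles _ _ _ _

lemma catD_catDesc {A : AddCommGrpCat.{u}} {q : koszulChains F 0 ⟶ A}
    (hq : koszulD F 0 ≫ q = 0) (τ : Fin 0 ↪o Fin n) : catD F 0 ≫ catDesc F q τ = 0 := by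
  refine catD_comp_eq_zero F fun {c c'} φ => ?_
  refine (congrArg (F.map φ ≫ ·) (catι_catDesc F q τ (ComposableArrows.mk₀ c'))).trans
    (Eq.trans ?_ (catι_catDesc F q τ (ComposableArrows.mk₀ c)).symm)
  exact map_elementMap F q hq τ φ.unop

/-- The homomorphism from the quotient of `C₀` to the quotient of `F(1)`. -/
def opcyclesInv : (catComplex F).opcycles 0 ⟶ (koszulComplex F).opcycles 0 :=
  (catComplex F).descOpcycles (catDesc F (koszulP F) (emptySequence n)) 1 (by simp)
    ((congrArg (· ≫ catDesc F (koszulP F) (emptySequence n)) (catComplex_d F 0)).trans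
      (catD_catDesc F (koszulD_koszulP F) _))

lemma catP_opcyclesInv :
    catP F ≫ opcyclesInv F = catDesc F (koszulP F) (emptySequence n) :=
  (catComplex F).p_descOpcycles _ _ _ _

lemma opcyclesMap_inv : opcyclesMap F ≫ opcyclesInv F = 𝟙 _ := by
  rw [← cancel_epi (koszulP F), Category.comp_id, ← Category.assoc, koszulP_opcyclesMap,
    Category.assoc, catP_opcyclesInv]
  refine koszulChains_hom_ext fun τ => ?_
  -- There is only one sequence of length zero, so `koszulChains F 0` has a single summand.
  obtain rfl : emptySequence n = τ := RelEmbedding.ext fun j => j.elim0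
  rw [← Category.assoc, koszulι_koszulToCat]
  exact (catι_catDesc F _ _ _).trans (elementMap_monomial F _ (koszulD_koszulP F) _)

/-- The component at `b` is `F` of a morphism between `1` and `b` followed by the inclusion of the
summand at `1`. In the colimit this equals the inclusion of the summand at `b`. -/
lemma opcyclesInv_map : opcyclesInv F ≫ opcyclesMap F = 𝟙 _ := by
  rw [← cancel_epi (catP F), Category.comp_id, ← Category.assoc, catP_opcyclesInv]
  refine catChains_hom_ext fun s => ?_
  rw [← Category.assoc, catι_catDesc, catι_eq_catPoint]
  refine (elementMap_comp F _ _ _ _).trans ?_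
  rw [koszulP_opcyclesMap, elementMap, factorizationMap, ← Category.assoc (koszulι F _),
    koszulι_koszulToCat]
  exact map_catPoint F (catD_catP F) _

/-- The isomorphism of the quotients of `C₀` and of `F(1)`. -/
def opcyclesIso : (catComplex F).opcycles 0 ≅ (koszulComplex F).opcycles 0 where
  hom := opcyclesInv F
  inv := opcyclesMap F
  hom_inv_id := opcyclesInv_map F
  inv_hom_id := opcyclesMap_inv F

lemma koszulMap_koszulToCat {F G : NaturalSystem.{u} (FreeCommMonoid n)} (α : F ⟶ G) :
    koszulMap α 0 ≫ koszulToCat G = koszulToCat F ≫ catMap α 0 := by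
  refine koszulChains_hom_ext fun τ => ?_
  rw [reassoc_of% koszulι_koszulMap, koszulι_koszulToCat, ← Category.assoc, koszulι_koszulToCat]
  exact (catι_catMap α _).symm

/-- The chain map of Koszul-type complexes induced by a natural transformation. -/
def koszulComplexMap {F G : NaturalSystem.{u} (FreeCommMonoid n)} (α : F ⟶ G) :
    koszulComplex F ⟶ koszulComplex G :=
  (koszulFunctor n).map α

/-- The chain map of the complexes `C_*` induced by a natural transformation. -/
def catComplexMap {F G : NaturalSystem.{u} (FreeCommMonoid n)} (α : F ⟶ G) :
    catComplex F ⟶ catComplex G :=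
  (catFunctor _).map α

lemma opcyclesMap_naturality {F G : NaturalSystem.{u} (FreeCommMonoid n)} (α : F ⟶ G) :
    HomologicalComplex.opcyclesMap (koszulComplexMap α) 0 ≫ opcyclesMap G =
      opcyclesMap F ≫ HomologicalComplex.opcyclesMap (catComplexMap α) 0 := by
  have h₁ : koszulP F ≫ HomologicalComplex.opcyclesMap (koszulComplexMap α) 0 =
      koszulMap α 0 ≫ koszulP G := HomologicalComplex.p_opcyclesMap _ _
  have h₂ : catP F ≫ HomologicalComplex.opcyclesMap (catComplexMap α) 0 =
      catMap α 0 ≫ catP G := HomologicalComplex.p_opcyclesMap _ _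
  rw [← cancel_epi (koszulP F), ← Category.assoc, ← Category.assoc, h₁, koszulP_opcyclesMap,
    Category.assoc, koszulP_opcyclesMap, ← Category.assoc, koszulMap_koszulToCat, Category.assoc,
    Category.assoc, h₂]

/-- The zeroth homology groups of `C_*` and of the Koszul-type complex agree, naturally in the
natural system. -/
def homologyZeroIso (n : ℕ) :
    catFunctor.{u} (MonoidFactorizations (FreeCommMonoid n))ᵒᵖ ⋙
        HomologicalComplex.homologyFunctor _ _ 0 ≅
      koszulFunctor n ⋙ HomologicalComplex.homologyFunctor _ _ 0 :=
  -- The isomorphism is assembled in the direction of `opcyclesMap`, whose naturality is checked on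
  -- `F(1)` alone, and is inverted at the end. In degree zero the homology is the cokernel of the
  -- incoming differential.
  (NatIso.ofComponents
    (fun F => (ChainComplex.isoHomologyι₀ (koszulComplex F)) ≪≫ (opcyclesIso F).symm ≪≫
      (ChainComplex.isoHomologyι₀ (catComplex F)).symm)
    (fun {F G} α => by
      change HomologicalComplex.homologyMap (koszulComplexMap α) 0 ≫
        (koszulComplex G).isoHomologyι₀.hom ≫ opcyclesMap G ≫ (catComplex G).isoHomologyι₀.inv =
          ((koszulComplex F).isoHomologyι₀.hom ≫ opcyclesMap F ≫
            (catComplex F).isoHomologyι₀.inv) ≫ HomologicalComplex.homologyMap (catComplexMap α) 0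
      simp only [Category.assoc, ChainComplex.isoHomologyι₀_inv_naturality]
      rw [← reassoc_of% opcyclesMap_naturality α]
      simp only [HomologicalComplex.isoHomologyι_hom,
        HomologicalComplex.homologyι_naturality_assoc])).symm

end Comparison

/-! ## Contraction of the complex of cells of a lattice -/

section Cells

variable {n : ℕ} {O A : Type*} [AddCommGroup A]

/-- Cells of the standard cubical structure of `O × ℝ^n`: the cell of `(o, S, x)` has the least
vertex `x` and the directions in `S`. -/
abbrev LatticeCell (n : ℕ) (O : Type*) : Type _ := O × Finset (Fin n) × (Fin n → ℕ)

/-- The sign of a direction of a cell. -/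
def dirSign (i : Fin n) (S : Finset (Fin n)) : ℤ := (-1) ^ (S.filter (· < i)).card

lemma dirSign_mul_self (i : Fin n) (S : Finset (Fin n)) : dirSign i S * dirSign i S = 1 := by
  rw [dirSign, ← mul_pow]
  simp

lemma dirSign_insert_self (i : Fin n) (S : Finset (Fin n)) :
    dirSign i (insert i S) = dirSign i S := by
  rw [dirSign, Finset.filter_insert, if_neg (lt_irrefl i), dirSign]

/-- Of the two directions, only the insertion of the smaller one changes the sign of the other. This
single change of sign makes faces and contractions in different directions anticommute. -/
lemma dirSign_insert_mul {i j : Fin n} (hij : i ≠ j) {S : Finset (Fin n)} (hi : i ∉ S)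
    (hj : j ∉ S) :
    dirSign i (insert j S) * dirSign j (insert i S) = -(dirSign j S * dirSign i S) := by
  have h : ∀ {i j : Fin n}, i < j → i ∉ S →
      dirSign i (insert j S) * dirSign j (insert i S) = -(dirSign j S * dirSign i S) := by
    intro i j h hi
    have hi' : i ∉ S.filter (· < j) := fun h' => hi (Finset.mem_filter.mp h').1
    rw [dirSign, dirSign, dirSign, dirSign, Finset.filter_insert, if_neg h.not_gt,
      Finset.filter_insert, if_pos h, Finset.card_insert_of_notMem hi', pow_succ]
    ring
  rcases lt_or_gt_of_ne hij with h' | h'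
  · exact h h' hi
  · rw [mul_comm, h h' hj, mul_comm]

/-- The part of the differential in the direction `i`. -/
def latticeFace (i : Fin n) : (LatticeCell n O →₀ A) →+ (LatticeCell n O →₀ A) :=
  Finsupp.liftAddHom fun c => if i ∈ c.2.1 then
    dirSign i c.2.1 • (Finsupp.singleAddHom (c.1, c.2.1.erase i, c.2.2 + Pi.single i 1) -
      Finsupp.singleAddHom (c.1, c.2.1.erase i, c.2.2)) else 0

lemma latticeFace_insert {i : Fin n} (o : O) {S : Finset (Fin n)} (hi : i ∉ S) (x : Fin n → ℕ)
    (a : A) : latticeFace i (Finsupp.single (o, insert i S, x) a) =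
      dirSign i S • (Finsupp.single (o, S, x + Pi.single i 1) a - Finsupp.single (o, S, x) a) := by
  rw [latticeFace, Finsupp.liftAddHom_apply_single]
  simp [Finset.erase_insert hi, dirSign_insert_self]

lemma latticeFace_of_notMem {i : Fin n} (o : O) {S : Finset (Fin n)} (hi : i ∉ S) (x : Fin n → ℕ)
    (a : A) : latticeFace i (Finsupp.single (o, S, x) a) = 0 := by
  rw [latticeFace, Finsupp.liftAddHom_apply_single]
  simp [hi]

/-- The contraction in the direction `i`. -/
def latticeHomotopy (i : Fin n) : (LatticeCell n O →₀ A) →+ (LatticeCell n O →₀ A) :=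
  Finsupp.liftAddHom fun c => if i ∈ c.2.1 then 0 else
    dirSign i c.2.1 • (∑ t ∈ Finset.range (c.2.2 i),
      Finsupp.singleAddHom (c.1, insert i c.2.1, Function.update c.2.2 i t) :
        A →+ (LatticeCell n O →₀ A))

lemma latticeHomotopy_of_notMem {i : Fin n} (o : O) {S : Finset (Fin n)} (hi : i ∉ S)
    (x : Fin n → ℕ) (a : A) : latticeHomotopy i (Finsupp.single (o, S, x) a) =
      dirSign i S • ∑ t ∈ Finset.range (x i),
        Finsupp.single (o, insert i S, Function.update x i t) a := by
  rw [latticeHomotopy, Finsupp.liftAddHom_apply_single]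
  simp [hi]

lemma latticeHomotopy_of_mem {i : Fin n} (o : O) {S : Finset (Fin n)} (hi : i ∈ S)
    (x : Fin n → ℕ) (a : A) : latticeHomotopy i (Finsupp.single (o, S, x) a) = 0 := by
  rw [latticeHomotopy, Finsupp.liftAddHom_apply_single]
  simp [hi]

/-- The projection in the direction `i`. -/
def latticeProj (i : Fin n) : (LatticeCell n O →₀ A) →+ (LatticeCell n O →₀ A) :=
  Finsupp.liftAddHom fun c => if i ∈ c.2.1 then 0 else
    Finsupp.singleAddHom (c.1, c.2.1, Function.update c.2.2 i 0)

lemma latticeProj_of_notMem {i : Fin n} (o : O) {S : Finset (Fin n)} (hi : i ∉ S)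
    (x : Fin n → ℕ) (a : A) : latticeProj i (Finsupp.single (o, S, x) a) =
      Finsupp.single (o, S, Function.update x i 0) a := by
  rw [latticeProj, Finsupp.liftAddHom_apply_single]
  simp [hi]

lemma latticeProj_of_mem {i : Fin n} (o : O) {S : Finset (Fin n)} (hi : i ∈ S)
    (x : Fin n → ℕ) (a : A) : latticeProj i (Finsupp.single (o, S, x) a) = 0 := by
  rw [latticeProj, Finsupp.liftAddHom_apply_single]
  simp [hi]

/-- The differential. -/
def latticeD : (LatticeCell n O →₀ A) →+ (LatticeCell n O →₀ A) := ∑ i, latticeFace i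

lemma latticeD_apply (z : LatticeCell n O →₀ A) : latticeD z = ∑ i, latticeFace i z := by
  simp [latticeD, AddMonoidHom.finsetSum_apply]

lemma update_add_single_ne {i j : Fin n} (h : i ≠ j) (x : Fin n → ℕ) (t : ℕ) :
    Function.update (x + Pi.single j 1) i t = Function.update x i t + Pi.single j 1 := by
  funext l
  rcases eq_or_ne l i with rfl | hl
  · simp [Pi.single_eq_of_ne h]
  · simp [Function.update_of_ne hl]

lemma update_add_single_same (i : Fin n) (x : Fin n → ℕ) (t : ℕ) :
    Function.update x i t + Pi.single i 1 = Function.update x i (t + 1) := by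
  funext l
  rcases eq_or_ne l i with rfl | hl
  · simp
  · simp [Function.update_of_ne hl, Pi.single_eq_of_ne hl]

lemma update_add_single_same' (i : Fin n) (x : Fin n → ℕ) (t : ℕ) :
    Function.update (x + Pi.single i 1) i t = Function.update x i t := by
  funext l
  rcases eq_or_ne l i with rfl | hl
  · simp
  · simp [Function.update_of_ne hl, Pi.single_eq_of_ne hl]

/-- The two operators alter different coordinates, so the cells on both sides agree, and the signs
are opposite by `dirSign_insert_mul`. When `i` is already a direction of the cell, or `j` is not,
both terms vanish. -/
lemma homotopy_face_add_ne {i j : Fin n} (hij : i ≠ j) (z : LatticeCell n O →₀ A) :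
    latticeHomotopy i (latticeFace j z) + latticeFace j (latticeHomotopy i z) = 0 := by
  induction z using Finsupp.induction_linear with
  | zero => simp
  | add z w hz hw =>
    simp only [map_add]
    rw [add_add_add_comm, hz, hw, add_zero]
  | single c a =>
    obtain ⟨o, S, x⟩ := c
    by_cases hi : i ∈ S
    · rw [latticeHomotopy_of_mem o hi, map_zero, add_zero]
      by_cases hj : j ∈ S
      · obtain ⟨S, hj', rfl⟩ : ∃ S', j ∉ S' ∧ S = insert j S' :=
          ⟨S.erase j, Finset.notMem_erase j S, (Finset.insert_erase hj).symm⟩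
        have hi' : i ∈ S := (Finset.mem_insert.mp hi).resolve_left hij
        rw [latticeFace_insert o hj', map_zsmul, map_sub, latticeHomotopy_of_mem o hi',
          latticeHomotopy_of_mem o hi', sub_zero, smul_zero]
      · rw [latticeFace_of_notMem o hj, map_zero]
    · rw [latticeHomotopy_of_notMem o hi, map_zsmul, map_sum]
      by_cases hj : j ∈ S
      · obtain ⟨S, hj', rfl⟩ : ∃ S', j ∉ S' ∧ S = insert j S' :=
          ⟨S.erase j, Finset.notMem_erase j S, (Finset.insert_erase hj).symm⟩
        have hi' : i ∉ S := fun h => hi (Finset.mem_insert_of_mem h)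
        have hj'' : j ∉ insert i S := by simp [hij.symm, hj']
        rw [latticeFace_insert o hj', map_zsmul, map_sub, latticeHomotopy_of_notMem o hi',
          latticeHomotopy_of_notMem o hi', Pi.add_apply, Pi.single_eq_of_ne hij, add_zero,
          ← smul_sub, ← Finset.sum_sub_distrib, smul_smul]
        simp only [Finset.insert_comm i j, latticeFace_insert o hj'', update_add_single_ne hij]
        rw [← Finset.smul_sum, smul_smul, dirSign_insert_mul hij hi' hj', neg_smul,
          add_neg_cancel]
      · have hj'' : j ∉ insert i S := by simp [hij.symm, hj]
        simp [latticeFace_of_notMem o hj, latticeFace_of_notMem o hj'']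

/-- In one coordinate this is the contraction of `[0, m]` to `0`: a vertex is sent to the path of
unit edges from `0` to it. -/
lemma homotopy_face_add_self (i : Fin n) (z : LatticeCell n O →₀ A) :
    latticeHomotopy i (latticeFace i z) + latticeFace i (latticeHomotopy i z) =
      z - latticeProj i z := by
  induction z using Finsupp.induction_linear with
  | zero => simp
  | add z w hz hw =>
    simp only [map_add]
    rw [add_add_add_comm, hz, hw]
    abel
  | single c a =>
    obtain ⟨o, S, x⟩ := c
    by_cases hi : i ∈ S
    · rw [latticeHomotopy_of_mem o hi, map_zero, add_zero, latticeProj_of_mem o hi, sub_zero]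
      obtain ⟨S, hi', rfl⟩ : ∃ S', i ∉ S' ∧ S = insert i S' :=
        ⟨S.erase i, Finset.notMem_erase i S, (Finset.insert_erase hi).symm⟩
      rw [latticeFace_insert o hi', map_zsmul, map_sub, latticeHomotopy_of_notMem o hi',
        latticeHomotopy_of_notMem o hi', ← smul_sub, smul_smul, dirSign_mul_self, one_smul]
      -- The paths to the two ends of the edge run over `range (x i + 1)` and `range (x i)`. Their
      -- difference is the term `t = x i`, the original cell.
      simp [update_add_single_same', Finset.sum_range_succ]
    · rw [latticeHomotopy_of_notMem o hi, latticeFace_of_notMem o hi, map_zero, zero_add,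
        latticeProj_of_notMem o hi, map_zsmul, map_sum]
      simp only [latticeFace_insert o hi, update_add_single_same]
      -- The boundaries of the unit edges telescope to the vertex minus its projection.
      rw [← Finset.smul_sum, smul_smul, dirSign_mul_self, one_smul,
        Finset.sum_range_sub (fun t => Finsupp.single (o, S, Function.update x i t) a)]
      simp

lemma proj_face (i j : Fin n) (z : LatticeCell n O →₀ A) :
    latticeProj i (latticeFace j z) = latticeFace j (latticeProj i z) := by
  induction z using Finsupp.induction_linear with
  | zero => simp
  | add z w hz hw => simp only [map_add, hz, hw]
  | single c a =>
    obtain ⟨o, S, x⟩ := c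
    by_cases hj : j ∈ S
    · obtain ⟨S, hj', rfl⟩ : ∃ S', j ∉ S' ∧ S = insert j S' :=
        ⟨S.erase j, Finset.notMem_erase j S, (Finset.insert_erase hj).symm⟩
      rw [latticeFace_insert o hj', map_zsmul, map_sub]
      by_cases hi : i ∈ S
      · rw [latticeProj_of_mem o hi, latticeProj_of_mem o hi,
          latticeProj_of_mem o (Finset.mem_insert_of_mem hi)]
        simp
      · rw [latticeProj_of_notMem o hi, latticeProj_of_notMem o hi]
        rcases eq_or_ne i j with rfl | hij
        -- The two opposite faces in the direction `i` have the same projection and cancel, in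
        -- accordance with the projection of the cell being zero.
        · rw [latticeProj_of_mem o (Finset.mem_insert_self i S), update_add_single_same']
          simp
        · rw [latticeProj_of_notMem o (by simp [hij, hi]), latticeFace_insert o hj',
            update_add_single_ne hij]
    · rw [latticeFace_of_notMem o hj, map_zero]
      by_cases hi : i ∈ S
      · rw [latticeProj_of_mem o hi, map_zero]
      · rw [latticeProj_of_notMem o hi, latticeFace_of_notMem o hj]

lemma homotopy_D_add (i : Fin n) (z : LatticeCell n O →₀ A) :
    latticeHomotopy i (latticeD z) + latticeD (latticeHomotopy i z) = z - latticeProj i z := by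
  rw [latticeD_apply, latticeD_apply, map_sum, ← Finset.sum_add_distrib,
    Finset.sum_eq_single_of_mem i (Finset.mem_univ i) fun j _ h => homotopy_face_add_ne h.symm z,
    homotopy_face_add_self]

lemma proj_D (i : Fin n) (z : LatticeCell n O →₀ A) :
    latticeProj i (latticeD z) = latticeD (latticeProj i z) := by
  simp only [latticeD_apply, map_sum, proj_face]

lemma map_mem_supported {C : Type*} {s t : Set C} {f : (C →₀ A) →+ (C →₀ A)}
    (h : ∀ c ∈ s, ∀ a, f (Finsupp.single c a) ∈ Finsupp.supported A ℤ t) {z : C →₀ A}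
    (hz : z ∈ Finsupp.supported A ℤ s) : f z ∈ Finsupp.supported A ℤ t := by
  rw [← z.sum_single, Finsupp.sum, map_sum]
  exact Submodule.sum_mem _ fun c hc => h c (hz hc) _

/-- The cells with `k` directions in the box with sides `[0, m o i]`. -/
def boxCells (m : O → Fin n → ℕ) (k : ℕ) : Set (LatticeCell n O) :=
  {c | c.2.1.card = k ∧ ∀ i, c.2.2 i + (if i ∈ c.2.1 then 1 else 0) ≤ m c.1 i}

/-- The added edges satisfy `t + 1 ≤ x i`, so contracting towards `0` never leaves the box. -/
lemma homotopy_mem_supported (m : O → Fin n → ℕ) (k : ℕ) (i : Fin n) {z : LatticeCell n O →₀ A}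
    (hz : z ∈ Finsupp.supported A ℤ (boxCells m k)) :
    latticeHomotopy i z ∈ Finsupp.supported A ℤ (boxCells m (k + 1)) := by
  refine map_mem_supported (fun c hc a => ?_) hz
  obtain ⟨o, S, x⟩ := c
  obtain ⟨hS, hx⟩ := hc
  by_cases hi : i ∈ S
  · rw [latticeHomotopy_of_mem o hi]
    exact Submodule.zero_mem _
  · rw [latticeHomotopy_of_notMem o hi]
    refine Submodule.smul_mem _ _ (Submodule.sum_mem _ fun t ht => ?_)
    refine Finsupp.single_mem_supported ℤ a ⟨?_, fun j => ?_⟩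
    · exact (Finset.card_insert_of_notMem hi).trans (congrArg (· + 1) hS)
    · have hj := hx j
      rw [Finset.mem_range] at ht
      rcases eq_or_ne j i with rfl | hne
      · simp [hi] at hj ⊢
        omega
      · simpa [hne, Function.update_of_ne hne] using hj

lemma proj_mem_supported (m : O → Fin n → ℕ) (k : ℕ) (i : Fin n) {z : LatticeCell n O →₀ A}
    (hz : z ∈ Finsupp.supported A ℤ (boxCells m k)) :
    latticeProj i z ∈ Finsupp.supported A ℤ (boxCells m k) := by
  refine map_mem_supported (fun c hc a => ?_) hz
  obtain ⟨o, S, x⟩ := c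
  obtain ⟨hS, hx⟩ := hc
  by_cases hi : i ∈ S
  · rw [latticeProj_of_mem o hi]
    exact Submodule.zero_mem _
  · rw [latticeProj_of_notMem o hi]
    refine Finsupp.single_mem_supported ℤ a ⟨hS, fun j => ?_⟩
    have hj := hx j
    rcases eq_or_ne j i with rfl | hne
    · simp [hi]
    · simpa [Function.update_of_ne hne] using hj

/-- Composites of projections kill the cells with one of the directions. -/
lemma foldl_proj_single_eq_zero (l : List (Fin n)) (o : O) {S : Finset (Fin n)} {i : Fin n}
    (hi : i ∈ S) (hl : i ∈ l) (x : Fin n → ℕ) (a : A) :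
    l.foldl (fun z j => latticeProj j z) (Finsupp.single (o, S, x) a) = 0 := by
  have h0 : ∀ l : List (Fin n), l.foldl (fun z j => latticeProj j z)
      (0 : LatticeCell n O →₀ A) = 0 := by
    intro l
    induction l with
    | nil => rfl
    | cons j l ih => rw [List.foldl_cons, map_zero, ih]
  induction l generalizing x with
  | nil => exact absurd hl (List.not_mem_nil)
  | cons j l ih =>
    rw [List.foldl_cons]
    by_cases hj : j ∈ S
    · rw [latticeProj_of_mem o hj, h0]
    · rw [latticeProj_of_notMem o hj]
      exact ih ((List.mem_cons.mp hl).resolve_left fun h => hj (h ▸ hi)) _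

/-- A cell of positive dimension has some direction, and the projection in that direction kills it.
Earlier projections do not change the set of directions of a surviving cell. -/
lemma foldl_proj_eq_zero (m : O → Fin n → ℕ) (k : ℕ) {z : LatticeCell n O →₀ A}
    (hz : z ∈ Finsupp.supported A ℤ (boxCells m (k + 1))) :
    (List.finRange n).foldl (fun z j => latticeProj j z) z = 0 := by
  have hsum : ∀ (l : List (Fin n)) {ι : Type _} (s : Finset ι) (f : ι → LatticeCell n O →₀ A),
      l.foldl (fun z j => latticeProj j z) (∑ c ∈ s, f c) =
        ∑ c ∈ s, l.foldl (fun z j => latticeProj j z) (f c) := by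
    intro l
    induction l with
    | nil => exact fun s f => rfl
    | cons j l ih => intro ι s f; rw [List.foldl_cons, map_sum, ih]; rfl
  rw [← z.sum_single, Finsupp.sum, hsum]
  refine Finset.sum_eq_zero fun c hc => ?_
  obtain ⟨o, S, x⟩ := c
  have hS : S.card = k + 1 := (hz hc).1
  obtain ⟨i, hi⟩ := Finset.card_pos.mp (by rw [hS]; exact Nat.succ_pos k)
  exact foldl_proj_single_eq_zero _ o hi (List.mem_finRange i) x _

/-- For a cycle `z`, the homotopy in the direction `j` bounds `z - latticeProj j z`, and the
projection is again a cycle in the box. Running through all directions, these differences telescope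
to `z` minus an iterated projection that is zero in positive dimension. -/
lemma exists_latticeD_eq (m : O → Fin n → ℕ) (k : ℕ) {z : LatticeCell n O →₀ A}
    (hz : z ∈ Finsupp.supported A ℤ (boxCells m (k + 1))) (hd : latticeD z = 0) :
    ∃ w ∈ Finsupp.supported A ℤ (boxCells m (k + 2)), latticeD w = z := by
  have key : ∀ (l : List (Fin n)) {z : LatticeCell n O →₀ A},
      z ∈ Finsupp.supported A ℤ (boxCells m (k + 1)) → latticeD z = 0 →
        ∃ w ∈ Finsupp.supported A ℤ (boxCells m (k + 2)),
          latticeD w = z - l.foldl (fun z j => latticeProj j z) z := by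
    intro l
    induction l with
    | nil => exact fun hz hd => ⟨0, Submodule.zero_mem _, by simp⟩
    | cons j l ih =>
      intro z hz hd
      obtain ⟨w, hw, hw'⟩ := ih (proj_mem_supported m _ j hz) (by rw [← proj_D, hd, map_zero])
      refine ⟨latticeHomotopy j z + w,
        Submodule.add_mem _ (homotopy_mem_supported m _ j hz) hw, ?_⟩
      have h := homotopy_D_add j z
      rw [hd, map_zero, zero_add] at h
      rw [map_add, h, hw', List.foldl_cons, sub_add_sub_cancel]
  obtain ⟨w, hw, hw'⟩ := key (List.finRange n) hz hd
  exact ⟨w, hw, by rw [hw', foldl_proj_eq_zero m k hz, sub_zero]⟩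

end Cells

/-! ## Acyclicity of induced natural systems for the Koszul-type complex -/

section KoszulAcyclic

variable {n : ℕ}

/-- The indices of a sequence `i₁ < ⋯ < iₖ`. -/
def indexSet {k : ℕ} (σ : Fin k ↪o Fin n) : Finset (Fin n) := Finset.univ.map σ.toEmbedding

lemma card_indexSet {k : ℕ} (σ : Fin k ↪o Fin n) : (indexSet σ).card = k := by
  simp [indexSet]

lemma mem_indexSet {k : ℕ} (σ : Fin k ↪o Fin n) (s : Fin k) : σ s ∈ indexSet σ :=
  Finset.mem_map_of_mem _ (Finset.mem_univ s)

lemma indexSet_injective {k : ℕ} :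
    Function.Injective (indexSet : (Fin k ↪o Fin n) → Finset (Fin n)) := by
  intro σ τ h
  refine OrderEmbedding.range_inj.mp ?_
  have h' := congrArg (fun S : Finset (Fin n) => (S : Set (Fin n))) h
  simpa [indexSet] using h'

lemma toAdd_monomial {k : ℕ} (σ : Fin k ↪o Fin n) (i : Fin n) :
    Multiplicative.toAdd (monomial σ) i = if i ∈ indexSet σ then 1 else 0 := by
  have h : Multiplicative.toAdd (monomial σ) i =
      ∑ j ∈ indexSet σ, (Pi.single j 1 : Fin n → ℕ) i := by
    rw [indexSet, Finset.sum_map, monomial, toAdd_prod, Finset.sum_apply]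
    rfl
  rw [h]
  simp [Pi.single_apply]

lemma erase_indexSet {k : ℕ} (σ : Fin (k + 1) ↪o Fin n) (s : Fin (k + 1)) :
    (indexSet σ).erase (σ s) = indexSet ((Fin.succAboveOrderEmb s).trans σ) := by
  ext i
  simp only [indexSet, Finset.mem_erase, Finset.mem_map, Finset.mem_univ, true_and]
  constructor
  · rintro ⟨hne, j, rfl⟩
    obtain ⟨l, rfl⟩ := Fin.exists_succAbove_eq (fun h : j = s => hne (congrArg σ h))
    exact ⟨l, rfl⟩
  · rintro ⟨l, rfl⟩
    exact ⟨fun h => Fin.succAbove_ne s l (σ.injective h), _, rfl⟩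

/-- Exactly `s` terms of the sequence precede its term at place `s`; this matches the Koszul sign
with the cubical one. -/
lemma dirSign_indexSet {k : ℕ} (σ : Fin k ↪o Fin n) (s : Fin k) :
    dirSign (σ s) (indexSet σ) = (-1) ^ (s : ℕ) := by
  have h : (indexSet σ).filter (· < σ s) = (Finset.Iio s).map σ.toEmbedding := by
    ext i
    simp only [indexSet, Finset.mem_filter, Finset.mem_map, Finset.mem_univ, true_and,
      Finset.mem_Iio]
    constructor
    · rintro ⟨⟨j, rfl⟩, h⟩
      exact ⟨j, σ.lt_iff_lt.mp h, rfl⟩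
    · rintro ⟨j, h, rfl⟩
      exact ⟨⟨j, rfl⟩, σ.lt_iff_lt.mpr h⟩
  rw [dirSign, h, Finset.card_map, Fin.card_Iio]

variable (n) in
/-- The index category of the natural systems. -/
abbrev SystemIndex : Type := (MonoidFactorizations (FreeCommMonoid n))ᵒᵖ

/-- The exponents of a monomial as an object of the category of factorizations. -/
def exponents (d : SystemIndex n) : Fin n → ℕ :=
  Multiplicative.toAdd (show FreeCommMonoid n from d.unop.arrow)

/-- The exponents of the first component of a morphism of the category of factorizations. -/
def firstExponents {d e : SystemIndex n} (f : d ⟶ e) : Fin n → ℕ :=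
  Multiplicative.toAdd (show FreeCommMonoid n from f.unop.f)

/-- The exponents of the second component of a morphism of the category of factorizations. -/
def secondExponents {d e : SystemIndex n} (f : d ⟶ e) : Fin n → ℕ :=
  Multiplicative.toAdd (show FreeCommMonoid n from f.unop.g)

lemma exponents_add {d e : SystemIndex n} (f : d ⟶ e) :
    secondExponents f + exponents e + firstExponents f = exponents d :=
  congrArg (fun a : FreeCommMonoid n => Multiplicative.toAdd a) f.unop.w

/-- The monoid is cancellative, so in a factorization of `d` around `e` the first outer factor
determines the second. -/
lemma hom_ext_firstExponents {d e : SystemIndex n} {f g : d ⟶ e}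
    (h : firstExponents f = firstExponents g) : f = g := by
  have h' : secondExponents f = secondExponents g := by
    have h₁ := (exponents_add f).trans (exponents_add g).symm
    rw [h] at h₁
    exact add_right_cancel (add_right_cancel h₁)
  exact Quiver.Hom.unop_inj (Factorizations.hom_ext h h')

/-- The cell of a sequence `i₁ < ⋯ < iₖ` and of a morphism. -/
def cellOf {k : ℕ} (σ : Fin k ↪o Fin n) {d : SystemIndex n}
    (f : d ⟶ op (Factorizations.ofElement (monomial σ))) : LatticeCell n (SystemIndex n) :=
  (d, indexSet σ, firstExponents f)

lemma exponents_monomial {k : ℕ} (σ : Fin k ↪o Fin n) (i : Fin n) :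
    exponents (op (Factorizations.ofElement (monomial σ))) i = if i ∈ indexSet σ then 1 else 0 :=
  toAdd_monomial σ i

lemma cellOf_mem {k : ℕ} (σ : Fin k ↪o Fin n) {d : SystemIndex n}
    (f : d ⟶ op (Factorizations.ofElement (monomial σ))) : cellOf σ f ∈ boxCells exponents k := by
  refine ⟨card_indexSet σ, fun i => ?_⟩
  have h := congrFun (exponents_add f) i
  simp only [Pi.add_apply, exponents_monomial] at h
  change firstExponents f i + (if i ∈ indexSet σ then 1 else 0) ≤ exponents d i
  omega

/-- Together with `cellOf_mem` and `cellOf_injective` this gives a bijection between the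
factorizations around square-free monomials of degree `k` and the `k`-cells of the boxes, one box
for each object `d`. -/
lemma exists_cellOf {k : ℕ} {c : LatticeCell n (SystemIndex n)} (hc : c ∈ boxCells exponents k) :
    ∃ (σ : Fin k ↪o Fin n) (d : SystemIndex n)
      (f : d ⟶ op (Factorizations.ofElement (monomial σ))), cellOf σ f = c := by
  obtain ⟨d, S, x⟩ := c
  obtain ⟨hS, hx⟩ := hc
  let σ : Fin k ↪o Fin n := S.orderEmbOfFin hS
  have hσ : indexSet σ = S := by
    rw [indexSet]
    exact Finset.map_orderEmbOfFin_univ S hS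
  -- The second factor is what remains of `d`; the box condition makes the truncated subtraction
  -- exact.
  let y : Fin n → ℕ := fun i => exponents d i - (x i + if i ∈ S then 1 else 0)
  have hw : y + exponents (op (Factorizations.ofElement (monomial σ))) + x = exponents d := by
    funext i
    simp only [Pi.add_apply, exponents_monomial, hσ, y]
    have := hx i
    simp only at this
    omega
  let f : Factorizations.ofElement (monomial σ) ⟶ d.unop :=
    { f := Multiplicative.ofAdd x
      g := Multiplicative.ofAdd y
      w := congrArg (fun z : Fin n → ℕ => (Multiplicative.ofAdd z : FreeCommMonoid n)) hw }
  exact ⟨σ, d, f.op, congrArg (fun S => (d, S, x)) hσ⟩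

lemma cellOf_injective {k : ℕ} {σ τ : Fin k ↪o Fin n} {d e : SystemIndex n}
    {f : d ⟶ op (Factorizations.ofElement (monomial σ))}
    {g : e ⟶ op (Factorizations.ofElement (monomial τ))} (h : cellOf σ f = cellOf τ g) :
    (⟨σ, d, f⟩ : Σ (σ : Fin k ↪o Fin n) (d : SystemIndex n),
      (d ⟶ op (Factorizations.ofElement (monomial σ)))) = ⟨τ, e, g⟩ := by
  obtain ⟨rfl, h₁, h₂⟩ : d = e ∧ indexSet σ = indexSet τ ∧
      firstExponents f = firstExponents g := by simpa [cellOf] using h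
  obtain rfl := indexSet_injective h₁
  rw [hom_ext_firstExponents h₂]

/-- The group `⨁ A` of the cells of a lattice. -/
def latticeChains (n : ℕ) (A : AddCommGrpCat.{u}) : AddCommGrpCat.{u} :=
  AddCommGrpCat.of (LatticeCell n (SystemIndex n) →₀ A)

/-- The inclusion of the summand of a cell. -/
def latticeι (A : AddCommGrpCat.{u}) (c : LatticeCell n (SystemIndex n)) :
    A ⟶ latticeChains n A :=
  AddCommGrpCat.ofHom (Finsupp.singleAddHom c)

/-- The differential of the complex of cells. -/
def latticeDifferential (n : ℕ) (A : AddCommGrpCat.{u}) : latticeChains n A ⟶ latticeChains n A :=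
  AddCommGrpCat.ofHom latticeD

variable (A : AddCommGrpCat.{u})

/-- The summand of the Koszul-type complex of an induced natural system given by a sequence and a
morphism. -/
def inducedKoszulι {k : ℕ} (σ : Fin k ↪o Fin n) {d : SystemIndex n}
    (f : d ⟶ op (Factorizations.ofElement (monomial σ))) :
    A ⟶ koszulChains (inducedFunctor (SystemIndex n) A) k :=
  inducedι A f ≫ koszulι (inducedFunctor (SystemIndex n) A) σ

variable {A} in
lemma inducedKoszul_hom_ext {k : ℕ} {B : AddCommGrpCat.{u}}
    {p q : koszulChains (inducedFunctor (SystemIndex n) A) k ⟶ B}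
    (h : ∀ (σ : Fin k ↪o Fin n) {d : SystemIndex n}
      (f : d ⟶ op (Factorizations.ofElement (monomial σ))),
      inducedKoszulι A σ f ≫ p = inducedKoszulι A σ f ≫ q) : p = q :=
  koszulChains_hom_ext fun σ => inducedSum_hom_ext fun f =>
    (Category.assoc _ _ _).symm.trans ((h σ f).trans (Category.assoc _ _ _))

lemma inducedKoszulι_D {k : ℕ} (σ : Fin (k + 1) ↪o Fin n) {d : SystemIndex n}
    (f : d ⟶ op (Factorizations.ofElement (monomial σ))) :
    inducedKoszulι A σ f ≫ koszulD (inducedFunctor (SystemIndex n) A) k =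
      ∑ s : Fin (k + 1), (-1 : ℤ) ^ ((s : ℕ) + 1) •
        (inducedKoszulι A ((Fin.succAboveOrderEmb s).trans σ) (f ≫ (rightInsertion σ s).op) -
          inducedKoszulι A ((Fin.succAboveOrderEmb s).trans σ) (f ≫ (leftInsertion σ s).op)) := by
  refine (Category.assoc _ _ _).trans ?_
  refine (congrArg (inducedι A f ≫ ·) (ι_koszulD _ σ)).trans ?_
  refine (Preadditive.comp_sum _ _ _).trans (Finset.sum_congr rfl fun s _ => ?_)
  refine (Preadditive.comp_zsmul _ _ _).trans (congrArg _ ?_)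
  refine (Preadditive.comp_sub _ _ _).trans (congrArg₂ (· - ·) ?_ ?_)
  · exact (reassoc_of% inducedι_map) f (rightInsertion σ s).op _
  · exact (reassoc_of% inducedι_map) f (leftInsertion σ s).op _

/-- The homomorphism from the Koszul-type complex of an induced natural system to the group of the
cells of a lattice. -/
def koszulToLattice (k : ℕ) :
    koszulChains (inducedFunctor (SystemIndex n) A) k ⟶ latticeChains n A :=
  Sigma.desc fun σ => inducedSumDesc fun f => latticeι A (cellOf σ f)

lemma inducedKoszulι_toLattice {k : ℕ} (σ : Fin k ↪o Fin n) {d : SystemIndex n}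
    (f : d ⟶ op (Factorizations.ofElement (monomial σ))) :
    inducedKoszulι A σ f ≫ koszulToLattice A k = latticeι A (cellOf σ f) := by
  refine (Category.assoc _ _ _).trans ?_
  refine (congrArg (inducedι A f ≫ ·) (Sigma.ι_desc _ σ)).trans ?_
  exact inducedι_desc _ f

open Classical in
/-- The component of the retraction of `koszulToLattice` at a cell. -/
def cellRetraction (k : ℕ) (c : LatticeCell n (SystemIndex n)) :
    A ⟶ koszulChains (inducedFunctor (SystemIndex n) A) k :=
  if h : ∃ p : Σ (σ : Fin k ↪o Fin n) (d : SystemIndex n),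
      (d ⟶ op (Factorizations.ofElement (monomial σ))), cellOf p.1 p.2.2 = c then
    inducedKoszulι A h.choose.1 h.choose.2.2 else 0

lemma cellRetraction_cellOf {k : ℕ} (σ : Fin k ↪o Fin n) {d : SystemIndex n}
    (f : d ⟶ op (Factorizations.ofElement (monomial σ))) :
    cellRetraction A k (cellOf σ f) = inducedKoszulι A σ f := by
  have h : ∃ p : Σ (σ : Fin k ↪o Fin n) (d : SystemIndex n),
      (d ⟶ op (Factorizations.ofElement (monomial σ))), cellOf p.1 p.2.2 = cellOf σ f :=
    ⟨⟨σ, d, f⟩, rfl⟩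
  have h' : h.choose = ⟨σ, d, f⟩ := cellOf_injective h.choose_spec
  rw [cellRetraction, dif_pos h, h']

/-- The retraction of `koszulToLattice`. -/
def latticeToKoszul (k : ℕ) :
    latticeChains n A ⟶ koszulChains (inducedFunctor (SystemIndex n) A) k :=
  AddCommGrpCat.ofHom (Finsupp.liftAddHom fun c => (cellRetraction A k c).hom)

lemma latticeι_toKoszul {k : ℕ} (σ : Fin k ↪o Fin n) {d : SystemIndex n}
    (f : d ⟶ op (Factorizations.ofElement (monomial σ))) :
    latticeι A (cellOf σ f) ≫ latticeToKoszul A k = inducedKoszulι A σ f := by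
  rw [← cellRetraction_cellOf A σ f]
  ext a
  exact Finsupp.liftAddHom_apply_single (fun c => (cellRetraction A k c).hom) (cellOf σ f) a

/-- The target is neither graded nor confined to the boxes, so the map is only a split monomorphism.
Its image, the chains supported on `k`-cells of the boxes, is determined by `koszulToLattice_mem`
and `latticeι_mem_range`. -/
lemma koszulToLattice_injective (k : ℕ) :
    Function.Injective (koszulToLattice (n := n) A k).hom := by
  have h : koszulToLattice (n := n) A k ≫ latticeToKoszul A k = 𝟙 _ :=
    inducedKoszul_hom_ext fun σ d f => by
      rw [← Category.assoc, inducedKoszulι_toLattice, latticeι_toKoszul, Category.comp_id]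
  exact Function.LeftInverse.injective (g := (latticeToKoszul A k).hom) fun z =>
    ConcreteCategory.congr_hom h z

lemma latticeD_single {k : ℕ} (σ : Fin (k + 1) ↪o Fin n) (d : SystemIndex n) (x : Fin n → ℕ)
    (a : A) : latticeD (Finsupp.single (d, indexSet σ, x) a) =
      ∑ s : Fin (k + 1), (-1 : ℤ) ^ (s : ℕ) •
        (Finsupp.single (d, indexSet ((Fin.succAboveOrderEmb s).trans σ),
            x + Pi.single (σ s) 1) a -
          Finsupp.single (d, indexSet ((Fin.succAboveOrderEmb s).trans σ), x) a) := by
  have h : ∀ i ∉ indexSet σ, latticeFace i (Finsupp.single (d, indexSet σ, x) a) = 0 :=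
    fun i hi => latticeFace_of_notMem d hi x a
  rw [latticeD_apply, ← Finset.sum_subset (Finset.subset_univ (indexSet σ)) fun i _ => h i,
    indexSet, Finset.sum_map]
  refine Finset.sum_congr rfl fun s _ => ?_
  rw [latticeFace]
  refine (Finsupp.liftAddHom_apply_single _ _ _).trans ?_
  change (if σ s ∈ indexSet σ then dirSign (σ s) (indexSet σ) •
    (Finsupp.singleAddHom (d, (indexSet σ).erase (σ s), x + Pi.single (σ s) 1) -
      Finsupp.singleAddHom (d, (indexSet σ).erase (σ s), x)) else 0 :
        A →+ (LatticeCell n (SystemIndex n) →₀ A)) a = _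
  rw [if_pos (mem_indexSet σ s), erase_indexSet, dirSign_indexSet]
  rfl

lemma firstExponents_comp {d e c : SystemIndex n} (f : d ⟶ e) (g : e ⟶ c) :
    firstExponents (f ≫ g) = firstExponents f + firstExponents g :=
  add_comm (firstExponents g) (firstExponents f)

lemma latticeι_differential {k : ℕ} (σ : Fin (k + 1) ↪o Fin n) (d : SystemIndex n)
    (x : Fin n → ℕ) : latticeι A (d, indexSet σ, x) ≫ latticeDifferential n A =
      ∑ s : Fin (k + 1), (-1 : ℤ) ^ (s : ℕ) •
        (latticeι A (d, indexSet ((Fin.succAboveOrderEmb s).trans σ), x + Pi.single (σ s) 1) -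
          latticeι A (d, indexSet ((Fin.succAboveOrderEmb s).trans σ), x)) := by
  ext a
  refine (latticeD_single A σ d x a).trans ?_
  -- Evaluation at `a` as an additive map on homomorphisms, in order to evaluate a sum of morphisms
  -- termwise.
  let ev : (A ⟶ latticeChains n A) →+ (LatticeCell n (SystemIndex n) →₀ A) :=
    { toFun := fun p => p.hom a, map_zero' := rfl, map_add' := fun _ _ => rfl }
  refine Eq.trans (Finset.sum_congr rfl fun s _ => ?_) (map_sum ev _ _).symm
  rw [map_zsmul, map_sub]
  rfl

/-- The least vertex records the first outer factor, so the insertion `(a, 1)` passes to the far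
face in that direction, while `(1, a)` gives the near face. -/
lemma cellOf_leftInsertion {k : ℕ} (σ : Fin (k + 1) ↪o Fin n) {d : SystemIndex n}
    (f : d ⟶ op (Factorizations.ofElement (monomial σ))) (s : Fin (k + 1)) :
    cellOf ((Fin.succAboveOrderEmb s).trans σ) (f ≫ (leftInsertion σ s).op) =
      (d, indexSet ((Fin.succAboveOrderEmb s).trans σ), firstExponents f + Pi.single (σ s) 1) :=
  congrArg (fun x => (d, indexSet ((Fin.succAboveOrderEmb s).trans σ), x))
    (firstExponents_comp f _)

lemma cellOf_rightInsertion {k : ℕ} (σ : Fin (k + 1) ↪o Fin n) {d : SystemIndex n}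
    (f : d ⟶ op (Factorizations.ofElement (monomial σ))) (s : Fin (k + 1)) :
    cellOf ((Fin.succAboveOrderEmb s).trans σ) (f ≫ (rightInsertion σ s).op) =
      (d, indexSet ((Fin.succAboveOrderEmb s).trans σ), firstExponents f) :=
  congrArg (fun x => (d, indexSet ((Fin.succAboveOrderEmb s).trans σ), x))
    ((firstExponents_comp f _).trans (add_zero (firstExponents f)))

/-- The extra sign in `(-1)^(s+1)` is absorbed by exchanging the two faces: right minus left
insertion in the Koszul differential is near minus far face in the box. -/
lemma koszulToLattice_D (k : ℕ) :
    koszulD (inducedFunctor (SystemIndex n) A) k ≫ koszulToLattice A k =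
      koszulToLattice A (k + 1) ≫ latticeDifferential n A := by
  refine inducedKoszul_hom_ext fun σ d f => ?_
  rw [← Category.assoc, ← Category.assoc, inducedKoszulι_D, inducedKoszulι_toLattice,
    Preadditive.sum_comp, cellOf, latticeι_differential]
  refine Finset.sum_congr rfl fun s _ => ?_
  rw [Preadditive.zsmul_comp, Preadditive.sub_comp, inducedKoszulι_toLattice,
    inducedKoszulι_toLattice, cellOf_leftInsertion, cellOf_rightInsertion, pow_succ, mul_neg_one,
    neg_smul, ← smul_neg, neg_sub]

lemma latticeι_mem_range {k : ℕ} {z : LatticeCell n (SystemIndex n) →₀ A}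
    (hz : z ∈ Finsupp.supported A ℤ (boxCells exponents k)) :
    ∃ w, (koszulToLattice A k).hom w = z := by
  rw [← z.sum_single, Finsupp.sum]
  refine sum_mem (S := (koszulToLattice (n := n) A k).hom.range) fun c hc => ?_
  obtain ⟨σ, d, f, rfl⟩ := exists_cellOf (hz hc)
  exact ⟨(inducedKoszulι A σ f).hom (z (cellOf σ f)),
    ConcreteCategory.congr_hom (inducedKoszulι_toLattice A σ f) (z (cellOf σ f))⟩

lemma koszulToLattice_mem (k : ℕ) (z : koszulChains (inducedFunctor (SystemIndex n) A) k) :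
    (koszulToLattice A k).hom z ∈ Finsupp.supported A ℤ (boxCells exponents k) := by
  let S := (Finsupp.supported A ℤ (boxCells (n := n) (exponents (n := n)) k)).toAddSubgroup
  -- Membership in the subgroup means vanishing in the quotient, and a homomorphism to the quotient
  -- can be tested on the summands.
  let q : latticeChains n A ⟶ AddCommGrpCat.of (_ ⧸ S) :=
    AddCommGrpCat.ofHom (QuotientAddGroup.mk' S)
  have h : koszulToLattice A k ≫ q = 0 := inducedKoszul_hom_ext fun σ d f => by
    rw [← Category.assoc, inducedKoszulι_toLattice, comp_zero]
    ext a
    exact (QuotientAddGroup.eq_zero_iff _).mpr (Finsupp.single_mem_supported ℤ a (cellOf_mem σ f))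
  exact (QuotientAddGroup.eq_zero_iff _).mp (ConcreteCategory.congr_hom h z)

/-- A cycle is carried to the cell complex and bounded there inside the boxes. The bounding chain
lifts because its support lies in the boxes, and injectivity shows that the lift bounds the original
cycle. -/
lemma isZero_koszulComplex_homology_inducedFunctor (k : ℕ) :
    IsZero ((koszulComplex (inducedFunctor (SystemIndex n) A)).homology (k + 1)) := by
  rw [← HomologicalComplex.exactAt_iff_isZero_homology,
    HomologicalComplex.exactAt_iff' _ (k + 2) (k + 1) k (by simp) (by simp),
    ShortComplex.ab_exact_iff]
  intro z hz
  have hz' : (koszulD (inducedFunctor (SystemIndex n) A) k).hom z = 0 := by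
    rw [← koszulComplex_d]
    exact hz
  have hD : ∀ (k : ℕ) (w : koszulChains (inducedFunctor (SystemIndex n) A) (k + 1)),
      (koszulToLattice A k).hom ((koszulD (inducedFunctor (SystemIndex n) A) k).hom w) =
        latticeD ((koszulToLattice A (k + 1)).hom w) :=
    fun k w => ConcreteCategory.congr_hom (koszulToLattice_D A k) w
  obtain ⟨y, hy, hy'⟩ := exists_latticeD_eq exponents k (koszulToLattice_mem A (k + 1) z)
    ((hD k z).symm.trans ((congrArg _ hz').trans (map_zero _)))
  obtain ⟨w, rfl⟩ := latticeι_mem_range A hy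
  refine ⟨w, ?_⟩
  have h : (koszulD (inducedFunctor (SystemIndex n) A) (k + 1)).hom w = z :=
    koszulToLattice_injective A (k + 1) ((hD (k + 1) w).trans hy')
  rw [← koszulComplex_d] at h
  exact h

end KoszulAcyclic

/-! ## The main theorem -/

section Main

variable {n : ℕ}

/-- The chain groups coincide by definition, so only the differentials have to be compared. `key`
makes them variables, so that their equality can be substituted. -/
lemma koszulComplex_eq (F : NaturalSystem.{u} (FreeCommMonoid n)) :
    koszulComplex F = cubicalComplex (restrictedSystem F) := by
  have key : ∀ {X : ℕ → AddCommGrpCat.{u}} {d d' : ∀ k, X (k + 1) ⟶ X k} (_ : d = d')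
      (sq : ∀ k, d (k + 1) ≫ d k = 0) (sq' : ∀ k, d' (k + 1) ≫ d' k = 0),
      ChainComplex.of X d sq = ChainComplex.of X d' sq' := by
    rintro X d _ rfl sq sq'
    rfl
  exact key (funext (koszulD_eq F)) (koszulD_comp F) (cubicalD_comp (restrictedSystem F))

lemma isZero_koszulComplex_X (F : NaturalSystem.{u} (FreeCommMonoid n)) {k : ℕ} (hk : n < k) :
    IsZero ((koszulComplex F).X k) := by
  have : IsEmpty (Fin k ↪o Fin n) :=
    ⟨fun σ => by simpa [hk.not_ge] using Fintype.card_le_of_embedding σ.toEmbedding⟩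
  rw [IsZero.iff_id_eq_zero]
  exact koszulChains_hom_ext (F := F) fun σ => isEmptyElim σ

lemma leechHomology_iso (F : NaturalSystem.{u} (FreeCommMonoid n)) (k : ℕ) :
    Nonempty (leechHomology (FreeCommMonoid n) F k ≅ (koszulComplex F).homology k) :=
  nonempty_homology_iso (catFunctor (SystemIndex n)) (koszulFunctor n) catFunctor_shortExact
    koszulFunctor_shortExact (homologyZeroIso n)
    -- One cover serves both complexes: the induced functor with coefficients in the product of the
    -- values of `F`.
    (fun F => ⟨_, inducedDesc F, inferInstance, fun k =>
      ⟨isZero_catComplex_homology_inducedFunctor _ k,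
        isZero_koszulComplex_homology_inducedFunctor _ k⟩⟩) k F

end Main

end LeechCubical

end

theorem mainTheorem12 (n : ℕ) (F : LeechCubical.NaturalSystem.{u} (LeechCubical.FreeCommMonoid n)) :
    (∀ k : ℕ, Nonempty (LeechCubical.leechHomology (LeechCubical.FreeCommMonoid n) F k ≅
      LeechCubical.cubicalHomology (LeechCubical.restrictedSystem F) k)) ∧
    (∀ k : ℕ, Nonempty (LeechCubical.leechHomology (LeechCubical.FreeCommMonoid n) F k ≅
      (LeechCubical.koszulComplex F).homology k)) ∧
    (∀ k : ℕ, n < k → IsZero ((LeechCubical.koszulComplex F).X k)) := by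
  exact ⟨fun k => (LeechCubical.leechHomology_iso F k).map fun i =>
      i ≪≫ (HomologicalComplex.homologyFunctor _ _ k).mapIso
        (eqToIso (LeechCubical.koszulComplex_eq F)),
    LeechCubical.leechHomology_iso F, fun k => LeechCubical.isZero_koszulComplex_X F⟩
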